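/- For each $n\ge 1$ let $y_1,\dots,y_n$ be observations, let $k$ be a symmetric real-valued kernel, and put $k_{ij}=k(y_i,y_j)$ (the observations and the kernel may change with $n$). Let $$\bar k=\frac1{n(n-1)}\sum_{i=1}^n\sum_{j\ne i}k_{ij},\qquad \tilde k_{ij}=(k_{ij}-\bar k)\,\mathbf 1_{\{i\ne j\}},\qquad \tilde k_{i\cdot}=\sum_{j\ne i}\tilde k_{ij}.$$ For a set $G\subset\{1,\dots,n\}$ of positions with $t=|G|$ elements let $$\alpha_G=\frac1{t(t-1)}\sum_{i\in G}\sum_{j\in G,\,j\ne i}k_{ij},\qquad \beta_G=\frac1{(n-t)(n-t-1)}\sum_{i\notin G}\sum_{j\notin G,\,j\ne i}k_{ij},$$ $$D_G=t(t-1)\alpha_G-(n-t)(n-t-1)\beta_G,$$ $$W_{r,G}=r\,\frac{n-t}{n}\,t(t-1)\,\alpha_G+\frac tn\,(n-t)(n-t-1)\,\beta_G,$$ where $r$ is a real constant. The permutation null distribution gives probability $1/n!$ to each of the $n!$ permutations of $(y_1,\dots,y_n)$; the statistics are computed from the permuted sequence, and $\mathsf E$ and $\mathsf{Var}$ are taken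 under this distribution. Let $Z_{D}=(D_G-\mathsf E D_G)/\sqrt{\mathsf{Var}(D_G)}$ and $Z_{W,r}=(W_{r,G}-\mathsf E W_{r,G})/\sqrt{\mathsf{Var}(W_{r,G})}$. Write $Z_D(t)$, $Z_{W,r}(t)$ when $G=\{1,\dots,t\}$, and $Z_D(t_1,t_2)$, $Z_{W,r}(t_1,t_2)$ when $G=\{i: t_1<i\le t_2\}$. Let $[x]$ be the integer part of $x$. Assume that $\sum_{i}\tilde k_{i\cdot}^2>0$ for all large $n$, and that, as $n\to\infty$, 1. (Condition 1) $\displaystyle\sum_{i=1}^n|\tilde k_{i\cdot}|^s=o\Big(\Big\{\sum_{i=1}^n\tilde k_{i\cdot}^2\Big\}^{s/2}\Big)$ for every integer $s>2$; 2. (Condition 2) $\displaystyle\sum_{i=1}^n\sum_{j\ne i}\tilde k_{ij}^2=o\Big(\sum_{i=1}^n\tilde k_{i\cdot}^2\Big)$. Then, as $n\to\infty$, under the permutation null distribution: 1. $\{Z_D([nu]):0<u<1\}$ converges in finite-dimensional distributions to a Gaussian process indexed by $\{u : 0<u<1\}$; 2. $\{Z_D([nu],[nv]):0<u<v<1\}$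 converges in finite-dimensional distributions to a two-dimensional Gaussian random field, that is, a real-valued Gaussian process indexed by $\{(u,v):0<u<v<1\}$; 3. for every $r\ne1$, $\{Z_{W,r}([nu]):0<u<1\}$ converges in finite-dimensional distributions to a Gaussian process indexed by $\{u : 0<u<1\}$; 4. for every $r\ne1$, $\{Z_{W,r}([nu],[nv]):0<u<v<1\}$ converges in finite-dimensional distributions to a two-dimensional Gaussian random field indexed by $\{(u,v):0<u<v<1\}$. -/

import Mathlib

open MeasureTheory ProbabilityTheory Filter Topology Asymptotics

noncomputable section

namespace KernelScan

/-! ### The permutation null distribution -/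

/-- Every set of permutations is measurable. -/
instance permMeasurableSpace (n : ℕ) : MeasurableSpace (Equiv.Perm (Fin n)) := ⊤

instance permDiscreteMeasurableSpace (n : ℕ) :
    DiscreteMeasurableSpace (Equiv.Perm (Fin n)) := ⟨fun _ => trivial⟩

/-- The permutation null: each of the `n!` permutations has probability `1 / n!`. -/
abbrev permNull (n : ℕ) : Measure (Equiv.Perm (Fin n)) :=
  (PMF.uniformOfFintype (Equiv.Perm (Fin n))).toMeasure

/-- The standardization `(f - E f) / √(Var f)` under the permutation null. -/
def standardize {n : ℕ} (f : Equiv.Perm (Fin n) → ℝ) (σ : Equiv.Perm (Fin n)) : ℝ :=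
  (f σ - ∫ τ, f τ ∂(permNull n)) / √(Var[f; permNull n])

/-! ### Two-group statistics of a data sequence `y` with kernel `k`

`G` is the set of positions of the first group, `Gᶜ` that of the second group. -/

section Statistics

variable {X : Type*} {n : ℕ}

/-- Average of the kernel over ordered pairs of distinct positions in `G`. -/
def withinMean (k : X → X → ℝ) (y : Fin n → X) (G : Finset (Fin n)) : ℝ :=
  1 / ((G.card : ℝ) * ((G.card : ℝ) - 1)) * ∑ i ∈ G, ∑ j ∈ G with j ≠ i, k (y i) (y j)

/-- `α`: the within-group average of the first group. -/
def alpha (k : X → X → ℝ) (y : Fin n → X) (G : Finset (Fin n)) : ℝ :=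
  withinMean k y G

/-- `β`: the within-group average of the second group. -/
def beta (k : X → X → ℝ) (y : Fin n → X) (G : Finset (Fin n)) : ℝ :=
  withinMean k y Gᶜ

/-- `D = t (t - 1) α - (n - t) (n - t - 1) β`, where `t` is the size of the first group. -/
def statD (k : X → X → ℝ) (y : Fin n → X) (G : Finset (Fin n)) : ℝ :=
  let t : ℝ := G.card
  t * (t - 1) * alpha k y G - (n - t) * (n - t - 1) * beta k y G

/-- `W_r = r ((n - t) / n) t (t - 1) α + (t / n) (n - t) (n - t - 1) β`, where `t` is the size of
the first group. -/
def statW (r : ℝ) (k : X → X → ℝ) (y : Fin n → X) (G : Finset (Fin n)) : ℝ :=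
  let t : ℝ := G.card
  r * ((n - t) / n) * (t * (t - 1)) * alpha k y G
    + t / n * ((n - t) * (n - t - 1)) * beta k y G

/-- `Z_D` for the first group `G`, as a random variable on the permutations of the data. -/
def ZD (k : X → X → ℝ) (y : Fin n → X) (G : Finset (Fin n)) : Equiv.Perm (Fin n) → ℝ :=
  standardize fun σ => statD k (y ∘ σ) G

/-- `Z_{W,r}` for the first group `G`, as a random variable on the permutations of the data. -/
def ZW (r : ℝ) (k : X → X → ℝ) (y : Fin n → X) (G : Finset (Fin n)) : Equiv.Perm (Fin n) → ℝ :=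
  standardize fun σ => statW r k (y ∘ σ) G

/-- `k̄`: the average of the kernel over ordered pairs of distinct observations. -/
def kbar (k : X → X → ℝ) (y : Fin n → X) : ℝ :=
  1 / ((n : ℝ) * ((n : ℝ) - 1)) * ∑ i, ∑ j with j ≠ i, k (y i) (y j)

/-- `k̃ i j = (k i j - k̄) 1_{i ≠ j}`. -/
def ktilde (k : X → X → ℝ) (y : Fin n → X) (i j : Fin n) : ℝ :=
  if i = j then 0 else k (y i) (y j) - kbar k y

/-- The row sum `k̃ i ·`. -/
def rowSum (k : X → X → ℝ) (y : Fin n → X) (i : Fin n) : ℝ :=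
  ∑ j with j ≠ i, ktilde k y i j

end Statistics

/-! ### The groups of the two alternatives

The observation number `i + 1` sits at position `i : Fin n`. -/

/-- The positions of the observations numbered `1, …, t`. -/
def initialGroup (n t : ℕ) : Finset (Fin n) := Finset.univ.filter fun i => i.val + 1 ≤ t

/-- The positions of the observations whose number lies in the interval `(t₁, t₂]`. -/
def intervalGroup (n t₁ t₂ : ℕ) : Finset (Fin n) :=
  Finset.univ.filter fun i => t₁ < i.val + 1 ∧ i.val + 1 ≤ t₂

/-- The index set `0 < u < 1`. -/
abbrev UnitTime : Type := {u : ℝ // 0 < u ∧ u < 1}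

/-- The index set `0 < u < v < 1`. -/
abbrev IntervalTime : Type := {p : ℝ × ℝ // 0 < p.1 ∧ p.1 < p.2 ∧ p.2 < 1}

/-! ### Convergence of finite-dimensional distributions to a Gaussian process -/

/-- There is a real Gaussian process indexed by `T` to whose finite-dimensional distributions those
of the processes `Z n`, under the permutation null, converge weakly. -/
def ConvergesToGaussian {T : Type} (Z : (n : ℕ) → T → Equiv.Perm (Fin n) → ℝ) : Prop :=
  ∃ (Ω : Type) (_ : MeasurableSpace Ω) (P : Measure Ω) (_ : IsProbabilityMeasure P)
    (Zlim : T → Ω → ℝ), IsGaussianProcess Zlim P ∧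
      ∀ I : Finset T, TendstoInDistribution
        (fun (n : ℕ) (σ : Equiv.Perm (Fin n)) (t : I) => Z n t σ) atTop
        (fun (ω : Ω) (t : I) => Zlim t ω) (fun n => permNull n) P

end KernelScan

end

/-! Write p = |G|/n and let x = 1_G - p be the centered indicator. The centered kernel matrix has
total sum zero, so expanding 1_G = p + x turns the double sums over G and over its complement into
combinations of a degenerate quadratic form Q = ∑ k̃(i,j) x(σ⁻¹ i) x(σ⁻¹ j) and a linear permutation
statistic L = ∑ x(i) ρ(σ i), with ρ the row sums. Up to constants, D = 2L and W_r = (r(1-p)+p) Q +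
2p(1-p)(r-1) L.

Put R = ∑ ρ(i)². By `expect_quadratic_sq_le`, E Q² ≤ 32R/(n-3) + 16 ∑∑ k̃², so Condition 2 forces
Q/√R → 0 in L², while L/√R keeps a positive limiting variance. For D, and for W_r with r ≠ 1 and p
bounded away from 0 and 1, the linear term therefore dominates, and the standardized statistic is
L²-close to a constant multiple of L/√R (`tendsto_expect_normalized_sub_sq`).

A linear combination of such L over several groups is again a linear permutation statistic with
bounded scores. Joint convergence thus reduces to the combinatorial central limit theorem
`norm_charFun_linearStat_sub_le`, proved by Stein's method with a random transposition: the
characteristic function nearly solves φ' = -vθφ, with an error governed by third and fourth power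
sums of ρ/√R, which Condition 1 sends to zero.

The limiting covariances are overlaps of intervals minus products of lengths, those of Brownian
bridge increments. `exists_bridge_increments` realizes them as inner products, and
`exists_isonormal` turns vectors into jointly Gaussian variables on one probability space. -/

namespace KernelScan

open scoped BigOperators RealInnerProductSpace

/-! ### Moments of linear and quadratic statistics of a uniform permutation -/

section PermutationMoments

variable {ι : Type*} [Fintype ι] [DecidableEq ι]

lemma expect_perm_comp_mul_right {M : Type*} [AddCommMonoid M] [Module ℚ≥0 M]
    (π : Equiv.Perm ι) (f : Equiv.Perm ι → M) : 𝔼 σ, f (σ * π) = 𝔼 σ, f σ :=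
  Fintype.expect_equiv (Equiv.mulRight π) _ _ fun _ => rfl

lemma expect_perm_inv {M : Type*} [AddCommMonoid M] [Module ℚ≥0 M]
    (f : Equiv.Perm ι → M) : 𝔼 σ, f σ⁻¹ = 𝔼 σ, f σ :=
  Fintype.expect_equiv (Equiv.inv _) _ _ fun _ => rfl

/-- The images of `k` distinct points under a uniform permutation are exchangeable. -/
lemma expect_perm_comp_injective {k : ℕ} (g : (Fin k → ι) → ℝ) {e e' : Fin k → ι}
    (he : Function.Injective e) (he' : Function.Injective e') :
    𝔼 σ : Equiv.Perm ι, g (fun i => σ (e i)) = 𝔼 σ : Equiv.Perm ι, g (fun i => σ (e' i)) := by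
  -- A permutation carrying one tuple to the other is absorbed by the invariance of the uniform law.
  obtain ⟨π, hπ⟩ := Equiv.Perm.exists_extending_pair e' e he' he
  rw [← expect_perm_comp_mul_right π (fun σ => g (fun i => σ (e' i)))]
  simp [hπ]

lemma expect_perm_apply_two (g : ι → ι → ℝ) {a b a' b' : ι} (h : a ≠ b) (h' : a' ≠ b') :
    𝔼 σ : Equiv.Perm ι, g (σ a) (σ b) = 𝔼 σ : Equiv.Perm ι, g (σ a') (σ b') :=
  expect_perm_comp_injective (fun x : Fin 2 → ι => g (x 0) (x 1)) (e := ![a, b]) (e' := ![a', b'])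
    (by intro i j; fin_cases i <;> fin_cases j <;> simp [h, h.symm])
    (by intro i j; fin_cases i <;> fin_cases j <;> simp [h', h'.symm])

lemma expect_perm_apply_three (g : ι → ι → ι → ℝ) {a b c a' b' c' : ι}
    (hab : a ≠ b) (hac : a ≠ c) (hbc : b ≠ c) (hab' : a' ≠ b') (hac' : a' ≠ c') (hbc' : b' ≠ c') :
    𝔼 σ : Equiv.Perm ι, g (σ a) (σ b) (σ c) = 𝔼 σ : Equiv.Perm ι, g (σ a') (σ b') (σ c') :=
  expect_perm_comp_injective (fun x : Fin 3 → ι => g (x 0) (x 1) (x 2))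
    (e := ![a, b, c]) (e' := ![a', b', c'])
    (by intro i j; fin_cases i <;> fin_cases j <;> simp [*, Ne.symm])
    (by intro i j; fin_cases i <;> fin_cases j <;> simp [*, Ne.symm])

lemma expect_perm_apply_four (g : ι → ι → ι → ι → ℝ) {a b c d a' b' c' d' : ι}
    (hab : a ≠ b) (hac : a ≠ c) (had : a ≠ d) (hbc : b ≠ c) (hbd : b ≠ d) (hcd : c ≠ d)
    (hab' : a' ≠ b') (hac' : a' ≠ c') (had' : a' ≠ d') (hbc' : b' ≠ c') (hbd' : b' ≠ d')
    (hcd' : c' ≠ d') :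
    𝔼 σ : Equiv.Perm ι, g (σ a) (σ b) (σ c) (σ d) =
      𝔼 σ : Equiv.Perm ι, g (σ a') (σ b') (σ c') (σ d') :=
  expect_perm_comp_injective (fun x : Fin 4 → ι => g (x 0) (x 1) (x 2) (x 3))
    (e := ![a, b, c, d]) (e' := ![a', b', c', d'])
    (by intro i j; fin_cases i <;> fin_cases j <;> simp [*, Ne.symm])
    (by intro i j; fin_cases i <;> fin_cases j <;> simp [*, Ne.symm])

/-- Swapping positions shows that the expectation is the same at every point; averaging over the
points first, for fixed `σ`, gives the plain average of `f`. -/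
lemma expect_perm_apply (f : ι → ℝ) (a : ι) : 𝔼 σ : Equiv.Perm ι, f (σ a) = 𝔼 i, f i := by
  have h : ∀ b, 𝔼 σ : Equiv.Perm ι, f (σ b) = 𝔼 σ : Equiv.Perm ι, f (σ a) := fun b => by
    rw [← expect_perm_comp_mul_right (Equiv.swap a b)]
    simp
  have : Nonempty ι := ⟨a⟩
  calc 𝔼 σ : Equiv.Perm ι, f (σ a) = 𝔼 _b : ι, 𝔼 σ : Equiv.Perm ι, f (σ a) := by
        rw [Fintype.expect_const]
    _ = 𝔼 b : ι, 𝔼 σ : Equiv.Perm ι, f (σ b) := by simp_rw [h]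
    _ = 𝔼 σ : Equiv.Perm ι, 𝔼 b : ι, f (σ b) := Finset.expect_comm _ _ _
    _ = 𝔼 σ : Equiv.Perm ι, 𝔼 i, f i :=
        Finset.expect_congr rfl fun σ _ => Fintype.expect_equiv σ _ _ fun _ => rfl
    _ = 𝔼 i, f i := Fintype.expect_const _

/-- For a centered `u`, the covariance of the values at two distinct points. -/
lemma expect_perm_mul_of_ne {u : ι → ℝ} (hu : ∑ i, u i = 0) {a b : ι} (hab : a ≠ b) :
    ((Fintype.card ι : ℝ) - 1) * 𝔼 σ : Equiv.Perm ι, u (σ a) * u (σ b) = -𝔼 i, u i ^ 2 := by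
  -- Centering kills the sum over `e`. Its diagonal term is the second moment and the other N - 1
  -- terms agree by exchangeability.
  have h0 : ∑ e, 𝔼 σ : Equiv.Perm ι, u (σ a) * u (σ e) = 0 := by
    rw [← Finset.expect_sum_comm]
    refine Finset.expect_eq_zero fun σ _ => ?_
    rw [← Finset.mul_sum, Equiv.sum_comp σ u, hu, mul_zero]
  have h1 : ∀ e, 𝔼 σ : Equiv.Perm ι, u (σ a) * u (σ e) =
      𝔼 σ : Equiv.Perm ι, u (σ a) * u (σ b) +
        if e = a then 𝔼 i, u i ^ 2 - 𝔼 σ : Equiv.Perm ι, u (σ a) * u (σ b) else 0 := by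
    intro e
    split_ifs with h
    · subst h
      rw [← expect_perm_apply _ e]
      simp [sq]
    · rw [add_zero]
      exact expect_perm_apply_two (fun x y => u x * u y) (Ne.symm h) hab
  rw [Finset.sum_congr rfl fun e _ => h1 e, Finset.sum_add_distrib] at h0
  simp only [Finset.sum_const, Finset.card_univ, nsmul_eq_mul,
    Finset.sum_ite_eq', Finset.mem_univ,
    if_true] at h0
  linarith

/-- The first moment of a centered linear permutation statistic. -/
lemma expect_linear (c : ι → ℝ) {d : ι → ℝ} (hd : ∑ i, d i = 0) :
    𝔼 σ : Equiv.Perm ι, ∑ i, c i * d (σ i) = 0 := by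
  rw [Finset.expect_sum_comm]
  refine Finset.sum_eq_zero fun i _ => ?_
  rw [← Finset.mul_expect, expect_perm_apply, Fintype.expect_eq_sum_div_card, hd]
  simp

/-- The second moment of a centered linear permutation statistic. -/
lemma expect_linear_sq (hι : 2 ≤ Fintype.card ι) (c : ι → ℝ) {d : ι → ℝ} (hd : ∑ i, d i = 0) :
    𝔼 σ : Equiv.Perm ι, (∑ i, c i * d (σ i)) ^ 2 =
      (∑ i, d i ^ 2) / ((Fintype.card ι : ℝ) - 1) *
        (∑ i, c i ^ 2 - (∑ i, c i) ^ 2 / Fintype.card ι) := by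
  have hN : (2 : ℝ) ≤ Fintype.card ι := by exact_mod_cast hι
  set N : ℝ := ((Fintype.card ι : ℕ) : ℝ)
  have hS : 𝔼 i, d i ^ 2 = (∑ i, d i ^ 2) / N := Fintype.expect_eq_sum_div_card _
  set S := ∑ i, d i ^ 2
  -- The covariance matrix of the values is S/(N-1) times the projection I - J/N, where J is the
  -- all-ones matrix.
  have h : ∀ i j, 𝔼 σ : Equiv.Perm ι, d (σ i) * d (σ j) =
      -(S / (N * (N - 1))) + if i = j then S / (N - 1) else 0 := by
    intro i j
    split_ifs with hij
    · subst hij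
      have := expect_perm_apply (fun x => d x ^ 2) i
      rw [hS] at this
      simp_rw [← sq, this]
      have : N - 1 ≠ 0 := by linarith
      field_simp
      ring
    · have := expect_perm_mul_of_ne hd hij
      rw [hS] at this
      have h1 : N - 1 ≠ 0 := by linarith
      field_simp at this ⊢
      linarith
  calc 𝔼 σ : Equiv.Perm ι, (∑ i, c i * d (σ i)) ^ 2
      = 𝔼 σ : Equiv.Perm ι, ∑ i, ∑ j, c i * c j * (d (σ i) * d (σ j)) := by
        refine Finset.expect_congr rfl fun σ _ => ?_
        rw [sq, Finset.sum_mul_sum]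
        exact Finset.sum_congr rfl fun i _ => Finset.sum_congr rfl fun j _ => by ring
    _ = ∑ i, ∑ j, c i * c j * 𝔼 σ : Equiv.Perm ι, d (σ i) * d (σ j) := by
        simp_rw [Finset.expect_sum_comm, Finset.mul_expect]
    _ = -(S / (N * (N - 1))) * (∑ i, c i) ^ 2 + S / (N - 1) * ∑ i, c i ^ 2 := by
        simp_rw [h, mul_add, Finset.sum_add_distrib]
        congr 1
        · rw [sq, Finset.sum_mul_sum, Finset.mul_sum]
          refine Finset.sum_congr rfl fun i _ => ?_
          rw [Finset.mul_sum]
          exact Finset.sum_congr rfl fun j _ => by ring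
        · simp [Finset.mul_sum]
          exact Finset.sum_congr rfl fun i _ => by ring
    _ = _ := by
        have : N - 1 ≠ 0 := by linarith
        field_simp
        ring

/-- Mixed fourth moments of a bounded centered function along a uniform permutation: they depend
only on the pattern of coincidences, and are small when some point occurs only once. -/
lemma exists_fourth_moments (hι : 4 ≤ Fintype.card ι) {u : ι → ℝ} (hu : ∑ i, u i = 0)
    (hb : ∀ i, |u i| ≤ 1) :
    ∃ m₄ m₃ m₂ : ℝ, (∀ a b c d, a ≠ b → c ≠ d →
      𝔼 σ : Equiv.Perm ι, u (σ a) * u (σ b) * (u (σ c) * u (σ d)) =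
        m₄ + (m₃ - m₄) * ((if a = c then 1 else 0) + (if a = d then 1 else 0) +
            (if b = c then 1 else 0) + (if b = d then 1 else 0)) +
          (m₂ - 2 * m₃ + m₄) * ((if a = c then 1 else 0) * (if b = d then 1 else 0) +
            (if a = d then 1 else 0) * (if b = c then 1 else 0))) ∧
      |m₂| ≤ 1 ∧ ((Fintype.card ι : ℝ) - 2) * |m₃| ≤ 2 ∧
      ((Fintype.card ι : ℝ) - 3) * |m₄| ≤ 3 * |m₃| := by
  obtain ⟨e⟩ : Nonempty (Fin 4 ↪ ι) := by
    apply Function.Embedding.nonempty_of_card_le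
    simpa using hι
  have hN : (4 : ℝ) ≤ Fintype.card ι := by exact_mod_cast hι
  obtain ⟨x, y, z, w, hxy, hxz, hxw, hyz, hyw, hzw⟩ :
      ∃ x y z w : ι, x ≠ y ∧ x ≠ z ∧ x ≠ w ∧ y ≠ z ∧ y ≠ w ∧ z ≠ w :=
    ⟨e 0, e 1, e 2, e 3, by simp⟩
  have habs : ∀ f : Equiv.Perm ι → ℝ, (∀ σ, |f σ| ≤ 1) → |𝔼 σ, f σ| ≤ 1 := fun f hf =>
    (Finset.abs_expect_le _ _).trans
      (Finset.expect_le Finset.univ_nonempty fun σ _ => hf σ)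
  have hprod : ∀ x y : ℝ, |x| ≤ 1 → |y| ≤ 1 → |x * y| ≤ 1 := fun x y hx hy => by
    rw [abs_mul]; exact mul_le_one₀ hx (abs_nonneg _) hy
  have h2 : ∀ a b, a ≠ b → 𝔼 σ : Equiv.Perm ι, u (σ a) * u (σ a) * (u (σ b) * u (σ b)) =
      𝔼 σ : Equiv.Perm ι, u (σ x) * u (σ x) * (u (σ y) * u (σ y)) := fun a b hab =>
    expect_perm_apply_two (fun p q => u p * u p * (u q * u q)) hab hxy
  have h3 : ∀ a b c, a ≠ b → a ≠ c → b ≠ c →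
      𝔼 σ : Equiv.Perm ι, u (σ a) * u (σ a) * (u (σ b) * u (σ c)) =
      𝔼 σ : Equiv.Perm ι, u (σ x) * u (σ x) * (u (σ y) * u (σ z)) := fun a b c h1 h2 h3 =>
    expect_perm_apply_three (fun p q r => u p * u p * (u q * u r)) h1 h2 h3 hxy hxz hyz
  have h4 : ∀ a b c d, a ≠ b → a ≠ c → a ≠ d → b ≠ c → b ≠ d → c ≠ d →
      𝔼 σ : Equiv.Perm ι, u (σ a) * u (σ b) * (u (σ c) * u (σ d)) =
      𝔼 σ : Equiv.Perm ι, u (σ x) * u (σ y) * (u (σ z) * u (σ w)) :=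
    fun a b c d h1 h2 h3 h4 h5 h6 =>
    expect_perm_apply_four (fun p q r s => u p * u q * (u r * u s)) h1 h2 h3 h4 h5 h6
      hxy hxz hxw hyz hyw hzw
  -- Summing out one free index yields linear relations: (N-2) m₃ is a sum of two bounded moments,
  -- and (N-3) m₄ = -3 m₃. This is the source of the decay in N.
  have hzero : ∀ f : Equiv.Perm ι → ℝ, ∑ e, 𝔼 σ : Equiv.Perm ι, f σ * u (σ e) = 0 := by
    intro f
    rw [← Finset.expect_sum_comm]
    refine Finset.expect_eq_zero fun σ _ => ?_
    rw [← Finset.mul_sum, Equiv.sum_comp σ u, hu, mul_zero]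
  refine ⟨𝔼 σ : Equiv.Perm ι, u (σ x) * u (σ y) * (u (σ z) * u (σ w)),
    𝔼 σ : Equiv.Perm ι, u (σ x) * u (σ x) * (u (σ y) * u (σ z)),
    𝔼 σ : Equiv.Perm ι, u (σ x) * u (σ x) * (u (σ y) * u (σ y)), ?_, ?_, ?_, ?_⟩
  -- Since a ≠ b and c ≠ d, at most two coincidences occur, and two only in one of the two full
  -- matchings. The last coefficient is fixed by m₄ + 2(m₃ - m₄) + (m₂ - 2m₃ + m₄) = m₂.
  · intro a b c d hab hcd
    by_cases hac : a = c
    · subst hac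
      by_cases hbd : b = d
      · subst hbd
        simp only [hab, hab.symm, if_true, if_false]
        refine ((Finset.expect_congr rfl fun σ _ => ?_).trans (h2 a b hab)).trans ?_ <;> ring
      · simp only [hab.symm, hcd, hbd, if_true, if_false]
        refine ((Finset.expect_congr rfl fun σ _ => ?_).trans (h3 a b d hab hcd hbd)).trans ?_ <;> ring
    · by_cases had : a = d
      · subst had
        by_cases hbc : b = c
        · subst hbc
          simp only [hab, hab.symm, if_true, if_false]
          refine ((Finset.expect_congr rfl fun σ _ => ?_).trans (h2 a b hab)).trans ?_ <;> ring
        · simp only [hab.symm, hac, hbc, if_true, if_false]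
          refine ((Finset.expect_congr rfl fun σ _ => ?_).trans (h3 a b c hab hac hbc)).trans ?_ <;> ring
      · by_cases hbc : b = c
        · subst hbc
          simp only [hac, had, hcd, if_true, if_false]
          refine ((Finset.expect_congr rfl fun σ _ => ?_).trans (h3 b a d hab.symm hcd had)).trans ?_ <;> ring
        · by_cases hbd : b = d
          · subst hbd
            simp only [hac, hbc, hab, if_true, if_false]
            refine ((Finset.expect_congr rfl fun σ _ => ?_).trans (h3 b a c hab.symm hbc hac)).trans ?_ <;> ring
          · simp only [hac, had, hbc, hbd, if_false]
            refine ((Finset.expect_congr rfl fun σ _ => ?_).trans (h4 a b c d hab hac had hbc hbd hcd)).trans ?_ <;> ring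
  · exact habs _ fun σ => hprod _ _ (hprod _ _ (hb _) (hb _)) (hprod _ _ (hb _) (hb _))
  · set m₃ := 𝔼 σ : Equiv.Perm ι, u (σ x) * u (σ x) * (u (σ y) * u (σ z))
    set m₂ := 𝔼 σ : Equiv.Perm ι, u (σ x) * u (σ x) * (u (σ y) * u (σ y)) with hm₂
    set m₁ := 𝔼 σ : Equiv.Perm ι, u (σ x) * u (σ x) * (u (σ y) * u (σ x)) with hm₁
    have hm₁' : |m₁| ≤ 1 :=
      habs _ fun σ => hprod _ _ (hprod _ _ (hb _) (hb _)) (hprod _ _ (hb _) (hb _))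
    have hm₂' : |m₂| ≤ 1 :=
      habs _ fun σ => hprod _ _ (hprod _ _ (hb _) (hb _)) (hprod _ _ (hb _) (hb _))
    have h0 := hzero fun σ => u (σ x) * u (σ x) * u (σ y)
    have h1 : ∀ e, 𝔼 σ : Equiv.Perm ι, u (σ x) * u (σ x) * u (σ y) * u (σ e) =
        m₃ + ((if e = x then m₁ - m₃ else 0) + (if e = y then m₂ - m₃ else 0)) := by
      intro e
      rw [show 𝔼 σ : Equiv.Perm ι, u (σ x) * u (σ x) * u (σ y) * u (σ e) =
        𝔼 σ : Equiv.Perm ι, u (σ x) * u (σ x) * (u (σ y) * u (σ e)) from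
        Finset.expect_congr rfl fun σ _ => by ring]
      by_cases hex : e = x
      · subst hex
        simp [hxy, ← hm₁]
      · by_cases hey : e = y
        · subst hey
          simp [hex, ← hm₂]
        · simp only [hex, hey, if_false, add_zero]
          exact h3 x y e hxy (Ne.symm hex) (Ne.symm hey)
    rw [Finset.sum_congr rfl fun e _ => h1 e, Finset.sum_add_distrib] at h0
    simp only [Finset.sum_add_distrib, Finset.sum_const, Finset.card_univ, nsmul_eq_mul,
    Finset.sum_ite_eq',
      Finset.mem_univ, if_true] at h0
    have h5 : ((Fintype.card ι : ℝ) - 2) * m₃ = -(m₁ + m₂) := by linarith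
    calc ((Fintype.card ι : ℝ) - 2) * |m₃| = |((Fintype.card ι : ℝ) - 2) * m₃| := by
          rw [abs_mul, abs_of_nonneg (by linarith : (0 : ℝ) ≤ (Fintype.card ι : ℝ) - 2)]
      _ ≤ |m₁| + |m₂| := by rw [h5, abs_neg]; exact abs_add_le _ _
      _ ≤ 2 := by linarith
  · set m₄ := 𝔼 σ : Equiv.Perm ι, u (σ x) * u (σ y) * (u (σ z) * u (σ w))
    set m₃ := 𝔼 σ : Equiv.Perm ι, u (σ x) * u (σ x) * (u (σ y) * u (σ z)) with hm₃
    have h0 := hzero fun σ => u (σ x) * u (σ y) * u (σ z)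
    have h1 : ∀ e, 𝔼 σ : Equiv.Perm ι, u (σ x) * u (σ y) * u (σ z) * u (σ e) =
        m₄ + ((if e = x then m₃ - m₄ else 0) + ((if e = y then m₃ - m₄ else 0) +
          (if e = z then m₃ - m₄ else 0))) := by
      intro e
      by_cases hex : e = x
      · subst hex
        simp only [hxy, hxz, if_true, if_false]
        refine ((Finset.expect_congr rfl fun σ _ => ?_).trans (h3 e y z hxy hxz hyz)).trans ?_ <;> ring
      · by_cases hey : e = y
        · subst hey
          simp only [hex, hyz, if_true, if_false]
          refine ((Finset.expect_congr rfl fun σ _ => ?_).trans (h3 e x z hxy.symm hyz hxz)).trans ?_ <;> ring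
        · by_cases hez : e = z
          · subst hez
            simp only [hex, hey, if_true, if_false]
            refine ((Finset.expect_congr rfl fun σ _ => ?_).trans (h3 e x y hxz.symm hyz.symm hxy)).trans ?_ <;> ring
          · simp only [hex, hey, hez, if_false, add_zero, mul_assoc]
            rw [← h4 x y z e hxy hxz (Ne.symm hex) hyz (Ne.symm hey) (Ne.symm hez)]
            simp only [mul_assoc]
    rw [Finset.sum_congr rfl fun e _ => h1 e, Finset.sum_add_distrib] at h0
    simp only [Finset.sum_add_distrib, Finset.sum_const, Finset.card_univ, nsmul_eq_mul,
    Finset.sum_ite_eq',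
      Finset.mem_univ, if_true] at h0
    have h5 : ((Fintype.card ι : ℝ) - 3) * m₄ = -(3 * m₃) := by linarith
    apply le_of_eq
    calc ((Fintype.card ι : ℝ) - 3) * |m₄| = |((Fintype.card ι : ℝ) - 3) * m₄| := by
          rw [abs_mul, abs_of_nonneg (by linarith : (0 : ℝ) ≤ (Fintype.card ι : ℝ) - 3)]
      _ = 3 * |m₃| := by rw [h5, abs_neg, abs_mul]; norm_num

/-- A degenerate quadratic permutation statistic is centered. -/
lemma expect_quadratic {a : ι → ι → ℝ} (hdiag : ∀ i, a i i = 0) (hsum : ∑ i, ∑ j, a i j = 0)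
    (u : ι → ℝ) :
    𝔼 σ : Equiv.Perm ι, ∑ i, ∑ j, a i j * (u (σ i) * u (σ j)) = 0 := by
  simp_rw [Finset.expect_sum_comm, ← Finset.mul_expect]
  by_cases h : ∃ x y : ι, x ≠ y
  · obtain ⟨x, y, hxy⟩ := h
    calc ∑ i, ∑ j, a i j * 𝔼 σ : Equiv.Perm ι, u (σ i) * u (σ j)
        = ∑ i, ∑ j, a i j * 𝔼 σ : Equiv.Perm ι, u (σ x) * u (σ y) := by
          refine Finset.sum_congr rfl fun i _ => Finset.sum_congr rfl fun j _ => ?_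
          by_cases hij : i = j
          · simp [hij, hdiag]
          · rw [expect_perm_apply_two (fun p q => u p * u q) hij hxy]
      _ = 0 := by simp_rw [← Finset.sum_mul, hsum, zero_mul]
  · push Not at h
    refine Finset.sum_eq_zero fun i _ => Finset.sum_eq_zero fun j _ => ?_
    rw [h i j, hdiag, zero_mul]

/-- The second moment of a degenerate quadratic permutation statistic. -/
lemma expect_quadratic_sq_le (hι : 4 ≤ Fintype.card ι) {a : ι → ι → ℝ}
    (hsymm : ∀ i j, a i j = a j i) (hdiag : ∀ i, a i i = 0) (hsum : ∑ i, ∑ j, a i j = 0)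
    {u : ι → ℝ} (hu : ∑ i, u i = 0) (hb : ∀ i, |u i| ≤ 1) :
    𝔼 σ : Equiv.Perm ι, (∑ i, ∑ j, a i j * (u (σ i) * u (σ j))) ^ 2 ≤
      32 / ((Fintype.card ι : ℝ) - 3) * ∑ i, (∑ j, a i j) ^ 2 + 16 * ∑ i, ∑ j, a i j ^ 2 := by
  obtain ⟨m₄, m₃, m₂, hm, h₂, h₃, h₄⟩ := exists_fourth_moments hι hu hb
  have hN : (4 : ℝ) ≤ Fintype.card ι := by exact_mod_cast hι
  set N : ℝ := ((Fintype.card ι : ℕ) : ℝ)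
  set R := ∑ i, (∑ j, a i j) ^ 2 with hR
  set A := ∑ i, ∑ j, a i j ^ 2 with hA
  -- The m₄ constant drops out because the entries of `a` sum to zero; each single coincidence
  -- produces the squared row sums, each full matching the squared entries.
  have key : 𝔼 σ : Equiv.Perm ι, (∑ i, ∑ j, a i j * (u (σ i) * u (σ j))) ^ 2 =
      4 * (m₃ - m₄) * R + 2 * (m₂ - 2 * m₃ + m₄) * A := by
    have hF : ∀ i j, ∑ k, ∑ l, a k l *
        (m₄ + (m₃ - m₄) * ((if i = k then 1 else 0) + (if i = l then 1 else 0) +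
            (if j = k then 1 else 0) + (if j = l then 1 else 0)) +
          (m₂ - 2 * m₃ + m₄) * ((if i = k then 1 else 0) * (if j = l then 1 else 0) +
            (if i = l then 1 else 0) * (if j = k then 1 else 0))) =
        (m₃ - m₄) * (2 * ∑ l, a i l + 2 * ∑ l, a j l) + (m₂ - 2 * m₃ + m₄) * (2 * a i j) := by
      intro i j
      have h1 : ∀ i, ∑ k, ∑ l, a k l * (if i = k then 1 else 0) = ∑ l, a i l := fun i => by
        rw [Finset.sum_comm]
        simp
      have h2 : ∀ i, ∑ k, ∑ l, a k l * (if i = l then 1 else 0) = ∑ l, a i l := fun i => by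
        simp [hsymm i]
      have h3 : ∀ i j, ∑ k, ∑ l, a k l * ((if i = k then 1 else 0) * (if j = l then 1 else 0)) =
          a i j := fun i j => by
        simp
      calc _ = m₄ * ∑ k, ∑ l, a k l + (m₃ - m₄) * (∑ k, ∑ l, a k l * (if i = k then 1 else 0) +
            ∑ k, ∑ l, a k l * (if i = l then 1 else 0) +
            ∑ k, ∑ l, a k l * (if j = k then 1 else 0) +
            ∑ k, ∑ l, a k l * (if j = l then 1 else 0)) + (m₂ - 2 * m₃ + m₄) *
            (∑ k, ∑ l, a k l * ((if i = k then 1 else 0) * (if j = l then 1 else 0)) +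
            ∑ k, ∑ l, a k l * ((if j = k then 1 else 0) * (if i = l then 1 else 0))) := by
              simp only [Finset.mul_sum, ← Finset.sum_add_distrib]
              exact Finset.sum_congr rfl fun k _ => Finset.sum_congr rfl fun l _ => by ring
        _ = _ := by
              rw [h1, h1, h2, h2, h3, h3, hsum, hsymm j i]
              ring
    calc 𝔼 σ : Equiv.Perm ι, (∑ i, ∑ j, a i j * (u (σ i) * u (σ j))) ^ 2
        = 𝔼 σ : Equiv.Perm ι, ∑ i, ∑ j, ∑ k, ∑ l,
            a i j * (a k l * (u (σ i) * u (σ j) * (u (σ k) * u (σ l)))) := by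
          refine Finset.expect_congr rfl fun σ _ => ?_
          simp only [sq, Finset.sum_mul, Finset.mul_sum]
          exact Finset.sum_congr rfl fun i _ => Finset.sum_congr rfl fun j _ =>
            Finset.sum_congr rfl fun k _ => Finset.sum_congr rfl fun l _ => by ring
      _ = ∑ i, ∑ j, a i j * ∑ k, ∑ l, a k l *
            𝔼 σ : Equiv.Perm ι, u (σ i) * u (σ j) * (u (σ k) * u (σ l)) := by
          simp_rw [Finset.expect_sum_comm, Finset.mul_sum, Finset.mul_expect]
      _ = ∑ i, ∑ j, a i j * ((m₃ - m₄) * (2 * ∑ l, a i l + 2 * ∑ l, a j l) +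
            (m₂ - 2 * m₃ + m₄) * (2 * a i j)) := by
          refine Finset.sum_congr rfl fun i _ => Finset.sum_congr rfl fun j _ => ?_
          by_cases hij : i = j
          · simp [hij, hdiag]
          rw [← hF i j]
          congr 1
          refine Finset.sum_congr rfl fun k _ => Finset.sum_congr rfl fun l _ => ?_
          by_cases hkl : k = l
          · simp [hkl, hdiag]
          rw [hm i j k l hij hkl]
      _ = _ := by
          have h1 : ∑ i, ∑ j, a i j * ∑ l, a i l = R := by
            simp_rw [← Finset.sum_mul, ← sq]
            rfl
          have h2 : ∑ i, ∑ j, a i j * ∑ l, a j l = R := by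
            rw [Finset.sum_comm, ← h1]
            simp_rw [fun i j => hsymm j i]
          have h3 : 4 * (m₃ - m₄) * R + 2 * (m₂ - 2 * m₃ + m₄) * A = 2 * (m₃ - m₄) *
            (∑ i, ∑ j, a i j * ∑ l, a i l + ∑ i, ∑ j, a i j * ∑ l, a j l) +
              2 * (m₂ - 2 * m₃ + m₄) * A := by rw [h1, h2]; ring
          rw [h3, hA]
          simp only [Finset.mul_sum, ← Finset.sum_add_distrib]
          refine Finset.sum_congr rfl fun i _ => Finset.sum_congr rfl fun j _ => ?_
          simp only [mul_add, Finset.mul_sum, Finset.sum_add_distrib]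
          simp only [← Finset.mul_sum]
          ring
  have hR0 : 0 ≤ R := Finset.sum_nonneg fun i _ => sq_nonneg _
  have hA0 : 0 ≤ A := Finset.sum_nonneg fun i _ => Finset.sum_nonneg fun j _ => sq_nonneg _
  -- The row sums must carry a factor 1/N: their squares are of the order of the variance of the
  -- linear part, which the quadratic part has to be negligible against.
  have b₃ : |m₃| ≤ 2 / (N - 3) := by
    rw [le_div_iff₀ (by linarith)]
    nlinarith [abs_nonneg m₃]
  have b₃' : |m₃| ≤ 1 := by nlinarith [abs_nonneg m₃]
  have b₄ : |m₄| ≤ 3 * |m₃| := by nlinarith [abs_nonneg m₄]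
  have e1 : 4 * (m₃ - m₄) ≤ 32 / (N - 3) := by
    have := neg_abs_le m₄
    have := le_abs_self m₃
    have : 32 / (N - 3) = 16 * (2 / (N - 3)) := by ring
    linarith
  have e2 : 2 * (m₂ - 2 * m₃ + m₄) ≤ 16 := by
    have := neg_abs_le m₃
    have := le_abs_self m₄
    have := le_abs_self m₂
    linarith
  rw [key]
  exact add_le_add (mul_le_mul_of_nonneg_right e1 hR0) (mul_le_mul_of_nonneg_right e2 hA0)

end PermutationMoments

lemma expect_abs_le_sqrt {κ : Type*} [Fintype κ] [Nonempty κ] (f : κ → ℝ) :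
    𝔼 i, |f i| ≤ √(𝔼 i, f i ^ 2) := by
  apply Real.le_sqrt_of_sq_le
  have := Finset.expect_mul_sq_le_sq_mul_sq Finset.univ (fun i => |f i|) (fun _ => (1 : ℝ))
  simpa using this

/-- The power series handles |x| ≤ 1; beyond that the trivial bound 2|x| is at most 2x². -/
lemma norm_exp_ofReal_mul_I_sub_one_sub_le (x : ℝ) :
    ‖Complex.exp (x * Complex.I) - 1 - x * Complex.I‖ ≤ 2 * x ^ 2 := by
  have hx : ‖(x * Complex.I : ℂ)‖ = |x| := by simp
  rcases le_or_gt |x| 1 with h | h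
  · have := Complex.norm_exp_sub_one_sub_id_le (x := x * Complex.I) (by rwa [hx])
    rw [hx, sq_abs] at this
    nlinarith [sq_nonneg x]
  · have h1 : ‖Complex.exp (x * Complex.I) - 1‖ ≤ |x| := by
      rw [mul_comm]
      exact Real.norm_exp_I_mul_ofReal_sub_one_le
    have h2 := norm_sub_le (Complex.exp (x * Complex.I) - 1) (x * Complex.I)
    rw [hx] at h2
    have := sq_abs x
    nlinarith

/-! ### Combinatorial central limit theorem by Stein's method -/

section CentralLimit

variable {ι : Type*} [Fintype ι]

/-- The linear permutation statistic with scores `c` and values `d`. -/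
def linearStat (c d : ι → ℝ) (σ : Equiv.Perm ι) : ℝ := ∑ i, c i * d (σ i)

/-- The increment of `linearStat` under a transposition of positions. -/
def swapIncrement (c d : ι → ℝ) (i j : ι) (σ : Equiv.Perm ι) : ℝ :=
  (c i - c j) * (d (σ j) - d (σ i))

lemma linearStat_mul_swap [DecidableEq ι] (c d : ι → ℝ) (i j : ι) (σ : Equiv.Perm ι) :
    linearStat c d (σ * Equiv.swap i j) = linearStat c d σ + swapIncrement c d i j σ := by
  by_cases hij : i = j
  · subst hij
    rw [Equiv.swap_self]
    change linearStat c d (σ * 1) = _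
    simp [swapIncrement]
  rw [← sub_eq_iff_eq_add', linearStat, linearStat, ← Finset.sum_sub_distrib]
  have h : ∀ k, c k * d ((σ * Equiv.swap i j) k) - c k * d (σ k) =
      (if k = i then c i * (d (σ j) - d (σ i)) else 0) +
        (if k = j then c j * (d (σ i) - d (σ j)) else 0) := by
    intro k
    by_cases hki : k = i
    · subst hki
      simp [hij, mul_sub]
    · by_cases hkj : k = j
      · subst hkj
        simp [hki, mul_sub]
      · simp [hki, hkj, Equiv.swap_apply_of_ne_of_ne hki hkj]
  simp_rw [h, Finset.sum_add_distrib]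
  simp [swapIncrement]
  ring

/-- Linear regression property of the exchangeable pair: a random transposition has mean drift
proportional to `-linearStat`, so Stein's identity holds with no error term. -/
lemma sum_swapIncrement {c d : ι → ℝ} (hd : ∑ i, d i = 0) (σ : Equiv.Perm ι) :
    ∑ i, ∑ j, swapIncrement c d i j σ = -(2 * Fintype.card ι * linearStat c d σ) := by
  have hd' : ∑ i, d (σ i) = 0 := by rw [Equiv.sum_comp σ d, hd]
  simp only [swapIncrement, linearStat, sub_mul, mul_sub, Finset.sum_sub_distrib,
    ← Finset.mul_sum, hd', ← Finset.sum_mul, Finset.sum_const, Finset.card_univ, nsmul_eq_mul]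
  simp only [mul_left_comm _ (Fintype.card ι : ℝ), ← Finset.mul_sum]
  ring

/-- Centering of both `c` and `d` removes every cross term but the square of the statistic. With ∑
d² = 1, division by 4N leaves a quantity fluctuating around (∑ c²)/N. -/
lemma sum_swapIncrement_sq {c d : ι → ℝ} (hc : ∑ i, c i = 0) (hd : ∑ i, d i = 0)
    (σ : Equiv.Perm ι) :
    ∑ i, ∑ j, swapIncrement c d i j σ ^ 2 =
      2 * Fintype.card ι * ∑ i, c i ^ 2 * d (σ i) ^ 2 + 2 * ((∑ i, c i ^ 2) * ∑ i, d i ^ 2) +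
        4 * linearStat c d σ ^ 2 := by
  have hd' : ∑ i, d (σ i) = 0 := by rw [Equiv.sum_comp σ d, hd]
  have hd2 : ∑ i, d (σ i) ^ 2 = ∑ i, d i ^ 2 := Equiv.sum_comp σ fun x => d x ^ 2
  have h : ∀ i j, swapIncrement c d i j σ ^ 2 =
      c i ^ 2 * d (σ i) ^ 2 + c j ^ 2 * d (σ j) ^ 2 + c i ^ 2 * d (σ j) ^ 2 +
      d (σ i) ^ 2 * c j ^ 2 - 2 * (c i ^ 2 * d (σ i)) * d (σ j) - 2 * d (σ i) * (c j ^ 2 * d (σ j))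
      - 2 * (c i * d (σ i) ^ 2) * c j - 2 * c i * (c j * d (σ j) ^ 2) +
      4 * (c i * d (σ i)) * (c j * d (σ j)) := fun i j => by
    rw [swapIncrement]; ring
  simp only [h, linearStat, Finset.sum_sub_distrib, Finset.sum_add_distrib,
    ← Finset.mul_sum, hd', hc, hd2, ← Finset.sum_mul, Finset.sum_const, Finset.card_univ,
    nsmul_eq_mul]
  simp only [mul_left_comm _ (Fintype.card ι : ℝ), ← Finset.mul_sum]
  ring

lemma sum_abs_swapIncrement_cube_le {c d : ι → ℝ} {C : ℝ} (hc : ∀ i, |c i| ≤ C)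
    (σ : Equiv.Perm ι) :
    ∑ i, ∑ j, |swapIncrement c d i j σ| ^ 3 ≤
      64 * C ^ 3 * Fintype.card ι * ∑ i, |d i| ^ 3 := by
  have hd3 : ∑ i, |d (σ i)| ^ 3 = ∑ i, |d i| ^ 3 := Equiv.sum_comp σ fun x => |d x| ^ 3
  have h : ∀ i j, |swapIncrement c d i j σ| ^ 3 ≤
      (2 * C) ^ 3 * (4 * (|d (σ i)| ^ 3 + |d (σ j)| ^ 3)) := by
    intro i j
    have h1 : |c i - c j| ≤ 2 * C := by
      linarith [abs_sub (c i) (c j), hc i, hc j]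
    have h2 : |d (σ j) - d (σ i)| ≤ |d (σ j)| + |d (σ i)| := abs_sub _ _
    rw [swapIncrement, abs_mul, mul_pow]
    have h3 : (|d (σ j)| + |d (σ i)|) ^ 3 ≤ 4 * (|d (σ i)| ^ 3 + |d (σ j)| ^ 3) := by
      nlinarith [mul_nonneg (add_nonneg (abs_nonneg (d (σ i))) (abs_nonneg (d (σ j))))
        (sq_nonneg (|d (σ i)| - |d (σ j)|))]
    exact mul_le_mul (pow_le_pow_left₀ (abs_nonneg _) h1 3)
      ((pow_le_pow_left₀ (abs_nonneg _) h2 3).trans h3) (by positivity)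
      (pow_nonneg ((abs_nonneg _).trans h1) 3)
  calc _ ≤ ∑ i, ∑ j, (2 * C) ^ 3 * (4 * (|d (σ i)| ^ 3 + |d (σ j)| ^ 3)) :=
        Finset.sum_le_sum fun i _ => Finset.sum_le_sum fun j _ => h i j
    _ = _ := by
        simp only [← Finset.mul_sum, Finset.sum_add_distrib, hd3, Finset.sum_const,
          Finset.card_univ, nsmul_eq_mul]
        ring

variable [DecidableEq ι]

/-- Stein's identity for the exchangeable pair given by a random transposition. -/
lemma stein_identity {c d : ι → ℝ} (hd : ∑ i, d i = 0) (g : ℝ → ℂ) :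
    4 * (Fintype.card ι : ℂ) * 𝔼 σ, (linearStat c d σ : ℂ) * g (linearStat c d σ) =
      𝔼 σ, ∑ i, ∑ j, (swapIncrement c d i j σ : ℂ) *
        (g (linearStat c d σ + swapIncrement c d i j σ) - g (linearStat c d σ)) := by
  -- Composing with the transposition exchanges the old and new values of the statistic and flips
  -- the sign of the increment.
  have h1 : ∀ i j, 𝔼 σ, (swapIncrement c d i j σ : ℂ) *
      g (linearStat c d σ + swapIncrement c d i j σ) =
      -𝔼 σ, (swapIncrement c d i j σ : ℂ) * g (linearStat c d σ) := by
    intro i j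
    rw [← expect_perm_comp_mul_right (Equiv.swap i j)
      (fun σ => (swapIncrement c d i j σ : ℂ) * g (linearStat c d σ)), ← Finset.expect_neg_distrib]
    refine Finset.expect_congr rfl fun σ _ => ?_
    rw [linearStat_mul_swap, ← neg_mul]
    congr 1
    simp [swapIncrement]
    ring
  simp_rw [Finset.expect_sum_comm, mul_sub, Finset.expect_sub_distrib, h1]
  calc _ = 𝔼 σ, (-2 : ℂ) * ((∑ i, ∑ j, swapIncrement c d i j σ : ℝ) * g (linearStat c d σ)) := by
        rw [Finset.mul_expect]
        refine Finset.expect_congr rfl fun σ _ => ?_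
        rw [sum_swapIncrement hd]
        push_cast
        ring
    _ = _ := by
        simp_rw [← Finset.mul_expect, Complex.ofReal_sum, Finset.sum_mul, Finset.expect_sum_comm,
          Finset.mul_sum]
        exact Finset.sum_congr rfl fun i _ => Finset.sum_congr rfl fun j _ => by ring

/-- The quadratic variation of `linearStat` along random transpositions concentrates. -/
lemma expect_abs_variation_sub_le (hι : 2 ≤ Fintype.card ι) {c d : ι → ℝ} {C : ℝ}
    (hc : ∀ i, |c i| ≤ C) (hc0 : ∑ i, c i = 0) (hd : ∑ i, d i = 0) (hd2 : ∑ i, d i ^ 2 = 1) :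
    𝔼 σ, |(∑ i, ∑ j, swapIncrement c d i j σ ^ 2) / (4 * Fintype.card ι) -
        (∑ i, c i ^ 2) / Fintype.card ι| ≤
      √(2 * C ^ 4 * ∑ i, d i ^ 4) + 2 * C ^ 2 / Fintype.card ι := by
  have hN : (2 : ℝ) ≤ Fintype.card ι := by exact_mod_cast hι
  set N : ℝ := ((Fintype.card ι : ℕ) : ℝ)
  have hsq : ∀ i, c i ^ 2 ≤ C ^ 2 := fun i => sq_le_sq' (by linarith [neg_abs_le (c i), hc i])
    ((le_abs_self _).trans (hc i))
  have hs : ∑ i, c i ^ 2 ≤ N * C ^ 2 := by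
    simpa using Finset.sum_le_sum fun i (_ : i ∈ Finset.univ) => hsq i
  have he : ∑ i, (d i ^ 2 - 1 / N) = 0 := by
    simp only [Finset.sum_sub_distrib, hd2, Finset.sum_const, Finset.card_univ, nsmul_eq_mul]
    change 1 - N * (1 / N) = 0
    field_simp
    ring
  have hT : 𝔼 σ, linearStat c d σ ^ 2 ≤ 2 * C ^ 2 := by
    have := expect_linear_sq hι c hd
    rw [hc0, hd2] at this
    change 𝔼 σ, linearStat c d σ ^ 2 = _ at this
    rw [this]
    change 1 / (N - 1) * (∑ i, c i ^ 2 - 0 ^ 2 / N) ≤ _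
    rw [zero_pow two_ne_zero, zero_div, sub_zero, div_mul_eq_mul_div, one_mul,
      div_le_iff₀ (by linarith)]
    nlinarith [sq_nonneg C]
  -- The fluctuation of the variation is itself a linear permutation statistic, with scores c² and
  -- centered values d² - 1/N, so the second moment formula applies again. The factor 2 bounds
  -- N/(N-1).
  have hU : 𝔼 σ, linearStat (fun i => c i ^ 2) (fun i => d i ^ 2 - 1 / N) σ ^ 2 ≤
      2 * C ^ 4 * ∑ i, d i ^ 4 := by
    have := expect_linear_sq hι (fun i => c i ^ 2) he
    refine this.trans_le ?_
    have h4 : ∑ i, (d i ^ 2 - 1 / N) ^ 2 ≤ ∑ i, d i ^ 4 := by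
      have : ∑ i, (d i ^ 2 - 1 / N) ^ 2 = ∑ i, d i ^ 4 - 1 / N := by
        calc _ = ∑ i, (d i ^ 4 - 2 / N * d i ^ 2 + 1 / N ^ 2) :=
              Finset.sum_congr rfl fun i _ => by ring
          _ = ∑ i, d i ^ 4 - 2 / N * 1 + N * (1 / N ^ 2) := by
              simp [Finset.sum_add_distrib, Finset.sum_sub_distrib, ← Finset.mul_sum, hd2, N]
          _ = _ := by field_simp; ring
      rw [this]
      have : 0 ≤ 1 / N := by positivity
      linarith
    have h5 : ∑ i, (c i ^ 2) ^ 2 - (∑ i, c i ^ 2) ^ 2 / N ≤ N * C ^ 4 := by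
      have h6 : ∑ i, (c i ^ 2) ^ 2 ≤ N * C ^ 4 := by
        have := Finset.sum_le_sum fun i (_ : i ∈ Finset.univ) =>
          pow_le_pow_left₀ (sq_nonneg (c i)) (hsq i) 2
        simp only [Finset.sum_const, Finset.card_univ, nsmul_eq_mul] at this
        calc _ ≤ _ := this
          _ = _ := by ring
      have : 0 ≤ (∑ i, c i ^ 2) ^ 2 / N := by positivity
      linarith
    have h7 : 0 ≤ ∑ i, d i ^ 4 := Finset.sum_nonneg fun i _ => by positivity
    calc (∑ i, (d i ^ 2 - 1 / N) ^ 2) / (N - 1) *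
          (∑ i, (c i ^ 2) ^ 2 - (∑ i, c i ^ 2) ^ 2 / N)
        ≤ (∑ i, d i ^ 4) / (N - 1) * (N * C ^ 4) := by
          have h8 : 0 < N - 1 := by linarith
          refine (mul_le_mul_of_nonneg_left h5 (by positivity)).trans ?_
          exact mul_le_mul_of_nonneg_right (div_le_div_of_nonneg_right h4 h8.le) (by positivity)
      _ ≤ _ := by
          have h8 : 0 < N - 1 := by linarith
          rw [div_mul_eq_mul_div, div_le_iff₀ h8]
          nlinarith [mul_nonneg h7 (by positivity : (0 : ℝ) ≤ C ^ 4)]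
  have hV : ∀ σ : Equiv.Perm ι, (∑ i, ∑ j, swapIncrement c d i j σ ^ 2) / (4 * N) -
      (∑ i, c i ^ 2) / N = 1 / 2 * linearStat (fun i => c i ^ 2) (fun i => d i ^ 2 - 1 / N) σ +
        linearStat c d σ ^ 2 / N := by
    intro σ
    rw [sum_swapIncrement_sq hc0 hd, hd2]
    have : linearStat (fun i => c i ^ 2) (fun i => d i ^ 2 - 1 / N) σ =
        ∑ i, c i ^ 2 * d (σ i) ^ 2 - (∑ i, c i ^ 2) / N := by
      simp only [linearStat, mul_sub, Finset.sum_sub_distrib, ← Finset.sum_mul]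
      ring
    rw [this]
    change (2 * N * _ + _ + _) / (4 * N) - _ = _
    field_simp
    ring
  calc _ ≤ 𝔼 σ, (|linearStat (fun i => c i ^ 2) (fun i => d i ^ 2 - 1 / N) σ| +
        linearStat c d σ ^ 2 / N) := by
        refine Finset.expect_le_expect fun σ _ => ?_
        rw [hV]
        refine (abs_add_le _ _).trans (add_le_add ?_ ?_)
        · rw [abs_mul, abs_of_pos (by norm_num : (0 : ℝ) < 1 / 2)]
          linarith [abs_nonneg (linearStat (fun i => c i ^ 2) (fun i => d i ^ 2 - 1 / N) σ)]
        · rw [abs_of_nonneg (by positivity)]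
    _ ≤ _ := by
        rw [Finset.expect_add_distrib, ← Finset.expect_div]
        refine add_le_add ((expect_abs_le_sqrt _).trans (Real.sqrt_le_sqrt hU)) ?_
        exact div_le_div_of_nonneg_right hT (by positivity)

/-- Approximate Stein equation satisfied by the characteristic function of `linearStat`. -/
lemma norm_expect_mul_exp_sub_le (hι : 2 ≤ Fintype.card ι) {c d : ι → ℝ} {C : ℝ}
    (hc : ∀ i, |c i| ≤ C) (hc0 : ∑ i, c i = 0) (hd : ∑ i, d i = 0) (hd2 : ∑ i, d i ^ 2 = 1)
    {θ : ℝ} (hθ : |θ| ≤ 1) :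
    ‖𝔼 σ, (linearStat c d σ : ℂ) * Complex.exp (θ * linearStat c d σ * Complex.I) -
      θ * Complex.I * (((∑ i, c i ^ 2) / Fintype.card ι : ℝ) : ℂ) *
        𝔼 σ, Complex.exp (θ * linearStat c d σ * Complex.I)‖ ≤
      32 * C ^ 3 * ∑ i, |d i| ^ 3 +
        (√(2 * C ^ 4 * ∑ i, d i ^ 4) + 2 * C ^ 2 / Fintype.card ι) := by
  have hN : (2 : ℝ) ≤ Fintype.card ι := by exact_mod_cast hι
  have hvar := expect_abs_variation_sub_le hι hc hc0 hd hd2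
  have hst := stein_identity (c := c) hd fun x => Complex.exp (θ * x * Complex.I)
  set N : ℝ := ((Fintype.card ι : ℕ) : ℝ)
  have hNC : (Fintype.card ι : ℂ) = (N : ℂ) := by simp [N]
  have hN0 : (N : ℂ) ≠ 0 := by
    rw [Complex.ofReal_ne_zero]
    linarith
  rw [hNC] at hst
  have hnorm : ∀ x : ℝ, ‖Complex.exp (θ * x * Complex.I)‖ = 1 := fun x => by
    rw [← Complex.ofReal_mul, Complex.norm_exp_ofReal_mul_I]
  have hθ2 : θ ^ 2 ≤ 1 := by rw [← sq_abs]; exact pow_le_one₀ (abs_nonneg _) hθ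
  set v : ℝ := (∑ i, c i ^ 2) / N
  have hpt : ∀ σ : Equiv.Perm ι, ∀ i j, ‖(swapIncrement c d i j σ : ℂ) *
      (Complex.exp (θ * (linearStat c d σ + swapIncrement c d i j σ : ℝ) * Complex.I) -
        Complex.exp (θ * linearStat c d σ * Complex.I)) -
      θ * Complex.I * (swapIncrement c d i j σ ^ 2 : ℝ) *
        Complex.exp (θ * linearStat c d σ * Complex.I)‖ ≤ 2 * |swapIncrement c d i j σ| ^ 3 := by
    intro σ i j
    set x := swapIncrement c d i j σ
    set t := linearStat c d σ
    have h1 : Complex.exp (θ * (t + x : ℝ) * Complex.I) =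
        Complex.exp (θ * t * Complex.I) * Complex.exp ((θ * x : ℝ) * Complex.I) := by
      rw [← Complex.exp_add]
      congr 1
      push_cast
      ring
    have h2 : (x : ℂ) * (Complex.exp (θ * (t + x : ℝ) * Complex.I) -
        Complex.exp (θ * t * Complex.I)) -
        θ * Complex.I * (x ^ 2 : ℝ) * Complex.exp (θ * t * Complex.I) =
        x * Complex.exp (θ * t * Complex.I) *
          (Complex.exp ((θ * x : ℝ) * Complex.I) - 1 - (θ * x : ℝ) * Complex.I) := by
      rw [h1]
      push_cast
      ring
    rw [h2, norm_mul, norm_mul, hnorm, mul_one, Complex.norm_real, Real.norm_eq_abs]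
    calc |x| * ‖Complex.exp ((θ * x : ℝ) * Complex.I) - 1 - (θ * x : ℝ) * Complex.I‖
        ≤ |x| * (2 * (θ * x) ^ 2) :=
          mul_le_mul_of_nonneg_left (norm_exp_ofReal_mul_I_sub_one_sub_le _) (abs_nonneg _)
      _ ≤ |x| * (2 * |x| ^ 2) := by
          refine mul_le_mul_of_nonneg_left ?_ (abs_nonneg _)
          rw [mul_pow, sq_abs]
          nlinarith [sq_nonneg x]
      _ = _ := by ring
  have hV : ∀ σ : Equiv.Perm ι, (((∑ i, ∑ j, swapIncrement c d i j σ ^ 2) / (4 * N) : ℝ) : ℂ) *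
      (4 * N) = ∑ i, ∑ j, ((swapIncrement c d i j σ ^ 2 : ℝ) : ℂ) := by
    intro σ
    push_cast
    field_simp
  set φ := fun σ : Equiv.Perm ι => Complex.exp (θ * linearStat c d σ * Complex.I)
  -- Two errors are made in Stein's identity for g(x) = exp(iθx): linearizing the increment of g
  -- costs a cubic remainder, and replacing the quadratic variation by v costs its deviation.
  have hdecomp : 4 * (N : ℂ) * (𝔼 σ, (linearStat c d σ : ℂ) * φ σ -
      θ * Complex.I * v * 𝔼 σ, φ σ) =
      𝔼 σ, (∑ i, ∑ j, ((swapIncrement c d i j σ : ℂ) *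
        (Complex.exp (θ * (linearStat c d σ + swapIncrement c d i j σ : ℝ) * Complex.I) - φ σ) -
        θ * Complex.I * (swapIncrement c d i j σ ^ 2 : ℝ) * φ σ) +
        4 * N * (θ * Complex.I * (((∑ i, ∑ j, swapIncrement c d i j σ ^ 2) / (4 * N) - v : ℝ) : ℂ) *
          φ σ)) := by
    rw [mul_sub, hst, Finset.mul_expect, Finset.mul_expect, ← Finset.expect_sub_distrib]
    refine Finset.expect_congr rfl fun σ _ => ?_
    have h1 : 4 * (N : ℂ) * (θ * Complex.I *
        (((∑ i, ∑ j, swapIncrement c d i j σ ^ 2) / (4 * N) - v : ℝ) : ℂ) * φ σ) =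
        ∑ i, ∑ j, θ * Complex.I * ((swapIncrement c d i j σ ^ 2 : ℝ) : ℂ) * φ σ -
          4 * N * (θ * Complex.I * v * φ σ) := by
      simp only [← Finset.mul_sum, ← Finset.sum_mul]
      rw [← hV, Complex.ofReal_sub]
      ring
    rw [h1]
    simp only [Finset.sum_sub_distrib]
    ring
  have h4N : ‖(4 * (N : ℂ))‖ = 4 * N := by
    rw [norm_mul, Complex.norm_real, Real.norm_of_nonneg (by linarith)]
    simp
  have hle : 4 * N * ‖𝔼 σ, (linearStat c d σ : ℂ) * φ σ - θ * Complex.I * v * 𝔼 σ, φ σ‖ ≤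
      𝔼 σ, (2 * (64 * C ^ 3 * N * ∑ i, |d i| ^ 3) +
        4 * N * |(∑ i, ∑ j, swapIncrement c d i j σ ^ 2) / (4 * N) - v|) := by
    rw [← h4N, ← norm_mul, hdecomp]
    refine (RCLike.norm_expect_le (K := ℝ)).trans (Finset.expect_le_expect fun σ _ => ?_)
    refine (norm_add_le _ _).trans (add_le_add ?_ ?_)
    · calc _ ≤ ∑ i, ∑ j, 2 * |swapIncrement c d i j σ| ^ 3 :=
            (norm_sum_le _ _).trans (Finset.sum_le_sum fun i _ =>
              (norm_sum_le _ _).trans (Finset.sum_le_sum fun j _ => hpt σ i j))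
        _ ≤ _ := by
            simp only [← Finset.mul_sum]
            exact mul_le_mul_of_nonneg_left (sum_abs_swapIncrement_cube_le hc σ) two_pos.le
    · rw [norm_mul, h4N, norm_mul, norm_mul, norm_mul, hnorm, Complex.norm_I, Complex.norm_real,
        Complex.norm_real, Real.norm_eq_abs, Real.norm_eq_abs, mul_one, mul_one]
      have : |θ| * |(∑ i, ∑ j, swapIncrement c d i j σ ^ 2) / (4 * N) - v| ≤
          |(∑ i, ∑ j, swapIncrement c d i j σ ^ 2) / (4 * N) - v| :=
        mul_le_of_le_one_left (abs_nonneg _) hθ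
      exact mul_le_mul_of_nonneg_left this (by linarith)
  rw [Finset.expect_add_distrib, Fintype.expect_const, ← Finset.mul_expect] at hle
  have hpos : 0 < 4 * N := by linarith
  refine le_of_mul_le_mul_left (hle.trans ?_) hpos
  have := mul_le_mul_of_nonneg_left hvar hpos.le
  linarith

/-- A quantitative combinatorial central limit theorem for characteristic functions. -/
theorem norm_charFun_linearStat_sub_le (hι : 2 ≤ Fintype.card ι) {c d : ι → ℝ} {C : ℝ}
    (hc : ∀ i, |c i| ≤ C) (hc0 : ∑ i, c i = 0) (hd : ∑ i, d i = 0) (hd2 : ∑ i, d i ^ 2 = 1) :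
    ‖𝔼 σ, Complex.exp (linearStat c d σ * Complex.I) -
      Real.exp (-((∑ i, c i ^ 2) / Fintype.card ι) / 2)‖ ≤
      32 * C ^ 3 * ∑ i, |d i| ^ 3 +
        (√(2 * C ^ 4 * ∑ i, d i ^ 4) + 2 * C ^ 2 / Fintype.card ι) := by
  set v : ℝ := (∑ i, c i ^ 2) / Fintype.card ι with hv
  have hv0 : 0 ≤ v := by positivity
  set ε := 32 * C ^ 3 * ∑ i, |d i| ^ 3 +
    (√(2 * C ^ 4 * ∑ i, d i ^ 4) + 2 * C ^ 2 / Fintype.card ι)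
  -- Characteristic function divided by that of the Gaussian of variance v. It would be constant for
  -- an exact Gaussian; here its derivative on [0,1] is at most exp(v/2) ε, and the factor exp(v/2)
  -- cancels at θ = 1.
  set ψ : ℝ → ℂ := fun θ => Complex.exp (v * θ ^ 2 / 2) *
    𝔼 σ, Complex.exp (θ * linearStat c d σ * Complex.I)
  set ψ' : ℝ → ℂ := fun θ => Complex.exp (v * θ ^ 2 / 2) *
    (Complex.I * (𝔼 σ, (linearStat c d σ : ℂ) * Complex.exp (θ * linearStat c d σ * Complex.I) -
      θ * Complex.I * v * 𝔼 σ, Complex.exp (θ * linearStat c d σ * Complex.I)))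
  have hder : ∀ θ : ℝ, HasDerivAt ψ (ψ' θ) θ := by
    intro θ
    have hid : HasDerivAt (fun θ : ℝ => (θ : ℂ)) 1 θ := Complex.ofRealCLM.hasDerivAt
    have h1 : HasDerivAt (fun θ : ℝ => Complex.exp (v * θ ^ 2 / 2))
        (Complex.exp (v * θ ^ 2 / 2) * (v * θ)) θ := by
      convert! (((hid.pow 2).const_mul (v : ℂ)).div_const 2).cexp using 1
      simp
      ring
    have h2 : HasDerivAt (fun θ : ℝ => 𝔼 σ, Complex.exp (θ * linearStat c d σ * Complex.I))
        (𝔼 σ, Complex.exp (θ * linearStat c d σ * Complex.I) *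
          (linearStat c d σ * Complex.I)) θ := by
      simp_rw [Fintype.expect_eq_sum_div_card]
      refine (HasDerivAt.fun_sum fun σ _ => ?_).div_const _
      convert! ((hid.mul_const (linearStat c d σ : ℂ)).mul_const Complex.I).cexp using 1
      simp
    convert! h1.mul h2 using 1
    have h3 : 𝔼 σ, Complex.exp (θ * linearStat c d σ * Complex.I) *
        (linearStat c d σ * Complex.I) =
        Complex.I * 𝔼 σ, (linearStat c d σ : ℂ) *
          Complex.exp (θ * linearStat c d σ * Complex.I) := by
      rw [Finset.mul_expect]
      exact Finset.expect_congr rfl fun σ _ => by ring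
    rw [h3]
    simp only [ψ']
    linear_combination (-(Complex.exp (v * θ ^ 2 / 2) * θ * v *
      𝔼 σ, Complex.exp (θ * linearStat c d σ * Complex.I))) * Complex.I_sq
  have hbound : ∀ θ ∈ Set.Ico (0 : ℝ) 1, ‖ψ' θ‖ ≤ Real.exp (v / 2) * ε := by
    intro θ hθ
    have habs : |θ| ≤ 1 := by rw [abs_of_nonneg hθ.1]; exact hθ.2.le
    have hexp : ‖Complex.exp (v * θ ^ 2 / 2)‖ ≤ Real.exp (v / 2) := by
      rw [show (v * θ ^ 2 / 2 : ℂ) = ((v * θ ^ 2 / 2 : ℝ) : ℂ) by push_cast; ring,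
        ← Complex.ofReal_exp, Complex.norm_real, Real.norm_of_nonneg (Real.exp_pos _).le]
      apply Real.exp_le_exp.2
      have : θ ^ 2 ≤ 1 := pow_le_one₀ hθ.1 hθ.2.le
      nlinarith
    simp only [ψ']
    rw [norm_mul, norm_mul, Complex.norm_I, one_mul]
    exact mul_le_mul hexp (norm_expect_mul_exp_sub_le hι hc hc0 hd hd2 habs) (norm_nonneg _)
      (Real.exp_pos _).le
  have hmv := norm_image_sub_le_of_norm_deriv_le_segment_01'
    (fun θ _ => (hder θ).hasDerivWithinAt) hbound
  have h0 : ψ 0 = 1 := by simp [ψ]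
  have h1 : ψ 1 - ψ 0 = Real.exp (v / 2) * (𝔼 σ, Complex.exp (linearStat c d σ * Complex.I) -
      Real.exp (-v / 2)) := by
    rw [h0, mul_sub, ← Complex.ofReal_mul, ← Real.exp_add]
    simp [ψ]
    ring_nf
    simp
  rw [h1, norm_mul, Complex.norm_real, Real.norm_of_nonneg (Real.exp_pos _).le] at hmv
  exact le_of_mul_le_mul_left hmv (Real.exp_pos _)

end CentralLimit

/-! ### Construction of the isonormal Gaussian process -/

section Isonormal

variable {Ω : Type*} [MeasurableSpace Ω] {P : Measure Ω}

lemma norm_toLp_two_sq (f : Lp ℝ 2 P) : ∫ ω, f ω ^ 2 ∂P = ‖f‖ ^ 2 := by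
  rw [← real_inner_self_eq_norm_sq, L2.inner_def]
  simp [sq]

lemma coeFn_sum_smul {κ : Type*} (s : Finset κ) (a : κ → ℝ) (g : κ → Lp ℝ 2 P) :
    (∑ i ∈ s, a i • g i : Lp ℝ 2 P) =ᵐ[P] fun ω => ∑ i ∈ s, a i * g i ω := by
  have h : ∀ᵐ ω ∂P, ∀ i ∈ s, (a i • g i : Lp ℝ 2 P) ω = a i * g i ω :=
    (ae_ball_iff s.countable_toSet).2 fun i _ => by
      filter_upwards [Lp.coeFn_smul (a i) (g i)] with ω hω
      simp [hω]
  filter_upwards [Lp.coeFn_finsetSum s fun i => a i • g i, h] with ω h1 h2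
  rw [h1, Finset.sum_apply]
  exact Finset.sum_congr rfl h2

variable [IsProbabilityMeasure P]

lemma integral_abs_le_sqrt {X : Ω → ℝ} (hX : MemLp X 2 P) : ∫ ω, |X ω| ∂P ≤ √(∫ ω, X ω ^ 2 ∂P) := by
  apply Real.le_sqrt_of_sq_le
  have h := variance_nonneg (fun ω => |X ω|) P
  rw [variance_eq_sub (X := fun ω => |X ω|) hX.abs] at h
  simpa using h

/-- The map x ↦ exp(ix) is 1-Lipschitz, so L² approximation passes to characteristic functions. This
serves both to extend Gaussianity by density and to discard negligible remainders. -/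
lemma norm_integral_exp_sub_le {X Y : Ω → ℝ} (hX : MemLp X 2 P) (hY : MemLp Y 2 P) :
    ‖∫ ω, Complex.exp (X ω * Complex.I) ∂P - ∫ ω, Complex.exp (Y ω * Complex.I) ∂P‖ ≤
      √(∫ ω, (X ω - Y ω) ^ 2 ∂P) := by
  have hint : ∀ {X : Ω → ℝ}, MemLp X 2 P →
      Integrable (fun ω => Complex.exp (X ω * Complex.I)) P := fun {X} hX => by
    refine Integrable.of_bound (C := 1) ?_ (ae_of_all _ fun ω => ?_)
    · have := hX.aestronglyMeasurable
      exact (Complex.continuous_exp.comp_aestronglyMeasurable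
        ((Complex.continuous_ofReal.comp_aestronglyMeasurable this).mul_const _))
    · rw [Complex.norm_exp_ofReal_mul_I]
  rw [← integral_sub (hint hX) (hint hY)]
  refine le_trans ?_ (integral_abs_le_sqrt (hX.sub hY))
  refine (norm_integral_le_integral_norm _).trans ?_
  refine integral_mono ((hint hX).sub (hint hY)).norm
    ((hX.sub hY).integrable one_le_two).abs fun ω => ?_
  have : Complex.exp (X ω * Complex.I) - Complex.exp (Y ω * Complex.I) =
      Complex.exp (Y ω * Complex.I) * (Complex.exp (Complex.I * (X ω - Y ω : ℝ)) - 1) := by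
    rw [mul_sub, ← Complex.exp_add, mul_one]
    congr 2
    push_cast
    ring
  rw [this, norm_mul, Complex.norm_exp_ofReal_mul_I, one_mul]
  exact Real.norm_exp_I_mul_ofReal_sub_one_le

lemma exists_linearIsometry_of_orthonormal {κ V H : Type*} [NormedAddCommGroup V]
    [InnerProductSpace ℝ V] [NormedAddCommGroup H] [InnerProductSpace ℝ H] [CompleteSpace H]
    (b : HilbertBasis κ ℝ V) {e : κ → H} (he : Orthonormal ℝ e) :
    ∃ T : V →ₗᵢ[ℝ] H, ∀ i, T (b i) = e i := by
  classical
  refine ⟨he.orthogonalFamily.linearIsometry.comp b.repr.toLinearIsometry, fun i => ?_⟩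
  exact (congrArg he.orthogonalFamily.linearIsometry (b.repr_self i)).trans
    ((he.orthogonalFamily.linearIsometry_apply_single (1 : ℝ)).trans (one_smul ℝ (e i)))

/-- An isometric linear embedding into `L²` realizing the isonormal Gaussian process. -/
theorem exists_isonormal (V : Type) [NormedAddCommGroup V] [InnerProductSpace ℝ V]
    [CompleteSpace V] :
    ∃ (Ω : Type) (_ : MeasurableSpace Ω) (P : Measure Ω) (_ : IsProbabilityMeasure P)
      (T : V →ₗᵢ[ℝ] Lp ℝ 2 P), ∀ f, P.map (T f) = gaussianReal 0 (‖f‖₊ ^ 2) := by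
  obtain ⟨w, b, -⟩ := exists_hilbertBasis ℝ V
  obtain ⟨Ω, mΩ, P, ξ, hm, hlaw, hind, hP⟩ := exists_iid w (gaussianReal 0 1)
  have hG : ∀ i, HasGaussianLaw (ξ i) P := fun i => (hlaw i).hasGaussianLaw
  have hL2 : ∀ i, MemLp (ξ i) 2 P := fun i => (hG i).memLp_two
  have hmean : ∀ i, ∫ ω, ξ i ω ∂P = 0 := fun i => by
    rw [(hlaw i).integral_eq, integral_id_gaussianReal]
  have hvar : ∀ i, ∫ ω, ξ i ω * ξ i ω ∂P = 1 := fun i => by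
    have h1 : Var[ξ i; P] = 1 := by
      rw [(hlaw i).variance_eq, variance_id_gaussianReal]
      simp
    rw [variance_eq_sub (hL2 i), hmean] at h1
    simpa [sq] using h1
  -- Independent standard Gaussians indexed by a Hilbert basis are orthonormal in L², so sending
  -- basis vectors to them defines an isometry.
  have horth : Orthonormal ℝ fun i => (hL2 i).toLp (ξ i) := by
    classical
    rw [orthonormal_iff_ite]
    intro i j
    rw [L2.inner_def]
    have h1 : ∫ ω, ⟪(hL2 i).toLp (ξ i) ω, (hL2 j).toLp (ξ j) ω⟫ ∂P =
        ∫ ω, ξ i ω * ξ j ω ∂P := by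
      refine integral_congr_ae ?_
      filter_upwards [(hL2 i).coeFn_toLp, (hL2 j).coeFn_toLp] with ω h1 h2
      simp [h1, h2, mul_comm]
    rw [h1]
    split_ifs with hij
    · subst hij
      exact hvar i
    · have := (hind.indepFun hij).integral_mul_eq_mul_integral
        (hL2 i).aestronglyMeasurable (hL2 j).aestronglyMeasurable
      simp only [Pi.mul_apply] at this
      rw [this, hmean, zero_mul]
  obtain ⟨T, hTb⟩ := exists_linearIsometry_of_orthonormal b horth
  have hmem : ∀ f, MemLp (T f) 2 P := fun f => Lp.memLp _
  have hchar : ∀ X : Ω → ℝ, AEStronglyMeasurable X P → ∀ t,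
      charFun (P.map X) t = ∫ ω, Complex.exp ((t * X ω : ℝ) * Complex.I) ∂P := fun X hX t => by
    rw [charFun_apply_real, integral_map hX.aemeasurable (by fun_prop)]
    simp
  have hfin : ∀ (s : Finset w) (a : w → ℝ),
      P.map (T (∑ i ∈ s, a i • b i)) = gaussianReal 0 (‖∑ i ∈ s, a i • b i‖₊ ^ 2) := by
    intro s a
    set f := ∑ i ∈ s, a i • b i with hf
    have hT : T f =ᵐ[P] fun ω => ∑ i ∈ s, a i * ξ i ω := by
      have h1 : T f = ∑ i ∈ s, a i • (hL2 i).toLp (ξ i) := by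
        rw [hf, map_sum]
        exact Finset.sum_congr rfl fun i _ => by rw [map_smul, hTb]
      have h2 : ∀ᵐ ω ∂P, ∀ i ∈ s, (hL2 i).toLp (ξ i) ω = ξ i ω :=
        (ae_ball_iff s.countable_toSet).2 fun i _ => (hL2 i).coeFn_toLp
      rw [h1]
      filter_upwards [coeFn_sum_smul s a fun i => (hL2 i).toLp (ξ i), h2] with ω h3 h4
      rw [h3]
      exact Finset.sum_congr rfl fun i hi => by rw [h4 i hi]
    have hGs : HasGaussianLaw (fun ω => ∑ i ∈ s, a i * ξ i ω) P := by
      have h1 : HasGaussianLaw (fun ω (i : s) => ξ i ω) P :=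
        iIndepFun.hasGaussianLaw (fun i => hG i)
          (hind.precomp (g := fun i : s => (i : w)) Subtype.val_injective)
      have h2 := h1.map_fun (∑ i : s, a i • ContinuousLinearMap.proj (R := ℝ) i)
      convert! h2 using 2 with ω
      rw [← Finset.sum_coe_sort]
      simp
    have hGT : HasGaussianLaw (T f) P := hGs.congr hT.symm
    have hm0 : ∫ ω, T f ω ∂P = 0 := by
      rw [integral_congr_ae hT, integral_finsetSum _ fun i _ =>
        ((hL2 i).integrable one_le_two).const_mul _]
      simp [integral_const_mul, hmean]
    have hv : Var[T f; P] = ‖f‖ ^ 2 := by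
      rw [variance_eq_sub (hmem f), hm0]
      simp only [Pi.pow_apply]
      rw [norm_toLp_two_sq, T.norm_map]
      ring
    rw [hGT.map_eq_gaussianReal, hm0, hv]
    congr 1
    rw [← coe_nnnorm, ← NNReal.coe_pow, Real.toNNReal_coe]
  refine ⟨Ω, mΩ, P, hP, T, fun f => ?_⟩
  apply Measure.ext_of_charFun
  ext t
  have hlim := b.hasSum_repr f
  -- Finite partial sums of the expansion of `f` are Gaussian with convergent variances, and they
  -- converge in L² under `T`; the two limits of their characteristic functions must agree.
  have h1 : Tendsto (fun s : Finset w => charFun (P.map (T (∑ i ∈ s, b.repr f i • b i))) t) atTop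
      (𝓝 (charFun (gaussianReal 0 (‖f‖₊ ^ 2)) t)) := by
    simp_rw [hfin, charFun_gaussianReal]
    have hn := (hlim.norm.pow 2)
    have : Continuous fun x : ℝ => Complex.exp (t * (0 : ℝ) * Complex.I - (x : ℂ) * t ^ 2 / 2) := by
      fun_prop
    convert! (this.tendsto _).comp hn using 2
  have h2 : Tendsto (fun s : Finset w => charFun (P.map (T (∑ i ∈ s, b.repr f i • b i))) t) atTop
      (𝓝 (charFun (P.map (T f)) t)) := by
    rw [tendsto_iff_norm_sub_tendsto_zero]
    have h3 : Tendsto (fun s : Finset w => |t| * ‖∑ i ∈ s, b.repr f i • b i - f‖) atTop (𝓝 0) := by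
      have h4 : Tendsto (fun s : Finset w => ∑ i ∈ s, b.repr f i • b i) atTop (𝓝 f) := hlim
      simpa using (tendsto_iff_norm_sub_tendsto_zero.1 h4).const_mul |t|
    refine squeeze_zero (fun _ => norm_nonneg _) (fun s => ?_) h3
    set g := ∑ i ∈ s, b.repr f i • b i
    rw [hchar _ (hmem g).aestronglyMeasurable, hchar _ (hmem f).aestronglyMeasurable]
    refine (norm_integral_exp_sub_le ((hmem g).const_mul t) ((hmem f).const_mul t)).trans ?_
    have h5 : ∫ ω, (t * T g ω - t * T f ω) ^ 2 ∂P = (|t| * ‖g - f‖) ^ 2 := by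
      rw [mul_pow, sq_abs, ← T.norm_map (g - f), ← norm_toLp_two_sq, map_sub,
        ← integral_const_mul]
      refine integral_congr_ae ?_
      filter_upwards [Lp.coeFn_sub (T g) (T f)] with ω hω
      rw [hω, Pi.sub_apply]
      ring
    rw [h5, Real.sqrt_sq (by positivity)]
  exact tendsto_nhds_unique h2 h1

end Isonormal

/-! ### Process convergence from characteristic functions -/

lemma integral_permNull {E : Type*} [NormedAddCommGroup E] [NormedSpace ℝ E] [CompleteSpace E]
    {n : ℕ} (f : Equiv.Perm (Fin n) → E) :
    ∫ σ, f σ ∂(permNull n) = (Fintype.card (Equiv.Perm (Fin n)) : ℝ)⁻¹ • ∑ σ, f σ := by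
  rw [PMF.integral_eq_sum, Finset.smul_sum]
  simp [PMF.uniformOfFintype_apply]

lemma integral_permNull_real {n : ℕ} (f : Equiv.Perm (Fin n) → ℝ) :
    ∫ σ, f σ ∂(permNull n) = 𝔼 σ, f σ := by
  rw [integral_permNull, Fintype.expect_eq_sum_div_card, smul_eq_mul, inv_mul_eq_div]

lemma integral_permNull_complex {n : ℕ} (f : Equiv.Perm (Fin n) → ℂ) :
    ∫ σ, f σ ∂(permNull n) = 𝔼 σ, f σ := by
  rw [integral_permNull, Fintype.expect_eq_sum_div_card, Complex.real_smul, Complex.ofReal_inv,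
    Complex.ofReal_natCast, inv_mul_eq_div]

lemma memLp_permNull {n : ℕ} (f : Equiv.Perm (Fin n) → ℝ) : MemLp f 2 (permNull n) :=
  .of_discrete

/-- Convergence of characteristic functions of all finite linear combinations to those of a
Gaussian process with covariance `⟪h s, h t⟫`. -/
theorem convergesToGaussian_of_tendsto_charFun {T V : Type} [NormedAddCommGroup V]
    [InnerProductSpace ℝ V] [CompleteSpace V] (h : T → V)
    {Z : (n : ℕ) → T → Equiv.Perm (Fin n) → ℝ}
    (H : ∀ (I : Finset T) (l : I → ℝ), Tendsto
      (fun n => 𝔼 σ, Complex.exp ((∑ t : I, l t * Z n t σ : ℝ) * Complex.I)) atTop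
      (𝓝 (Real.exp (-‖∑ t : I, l t • h t‖ ^ 2 / 2) : ℂ))) :
    ConvergesToGaussian Z := by
  obtain ⟨Ω, mΩ, P, hP, W, hW⟩ := exists_isonormal V
  have hmeas : ∀ f, AEMeasurable (W f) P := fun f => (Lp.aestronglyMeasurable _).aemeasurable
  have hlin : ∀ (I : Finset T) (l : I → ℝ), (fun ω => ∑ t : I, l t * W (h t) ω) =ᵐ[P]
      W (∑ t : I, l t • h t) := fun I l => by
    rw [map_sum]
    simp_rw [map_smul]
    exact (coeFn_sum_smul Finset.univ l fun t : I => W (h t)).symm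
  have hlaw : ∀ (I : Finset T) (l : I → ℝ), P.map (fun ω => ∑ t : I, l t * W (h t) ω) =
      gaussianReal 0 (‖∑ t : I, l t • h t‖₊ ^ 2) := fun I l => by
    rw [Measure.map_congr (hlin I l), hW]
  classical
  refine ⟨Ω, mΩ, P, hP, fun t => W (h t), ⟨fun I => ⟨?_⟩⟩, fun I => ?_⟩
  · refine isGaussian_of_map_eq_gaussianReal fun L => ?_
    refine ⟨_, _, Eq.trans ?_ (hlaw I fun t => L fun j => if t = j then 1 else 0)⟩
    change (P.map fun ω (t : I) => W (h t) ω).map L = _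
    rw [AEMeasurable.map_map_of_aemeasurable L.continuous.measurable.aemeasurable
      (aemeasurable_pi_lambda _ fun t => hmeas _)]
    congr 1
    ext ω
    simp only [Function.comp_apply]
    refine (L.toLinearMap.pi_apply_eq_sum_univ _).trans ?_
    exact Finset.sum_congr rfl fun t _ => mul_comm _ _
  -- Lévy's continuity theorem needs an inner product, so the vectors are moved to Euclidean space
  -- and back by a continuous map.
  · have key : TendstoInDistribution
        (fun (n : ℕ) (σ : Equiv.Perm (Fin n)) => WithLp.toLp 2 fun t : I => Z n t σ) atTop
        (fun ω => WithLp.toLp 2 fun t : I => W (h t) ω) (fun n => permNull n) P := by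
      have hm : AEMeasurable (fun ω => WithLp.toLp 2 fun t : I => W (h t) ω) P :=
        (WithLp.measurable_toLp 2 _).comp_aemeasurable (aemeasurable_pi_lambda _ fun t => hmeas _)
      refine ⟨fun n => Measurable.of_discrete.aemeasurable, hm, ?_⟩
      refine ProbabilityMeasure.tendsto_of_tendsto_charFun fun s => ?_
      have hinner : ∀ x : I → ℝ, ⟪WithLp.toLp 2 x, s⟫ = ∑ t : I, s t * x t := fun x => by
        simp [PiLp.inner_apply]
      convert! H I s using 2 with n
      · change charFun ((permNull n).map _) s = _
        rw [charFun_apply, integral_map Measurable.of_discrete.aemeasurable (by fun_prop)]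
        rw [integral_permNull_complex]
        simp_rw [hinner]
      · change charFun (P.map _) s = _
        rw [charFun_apply, integral_map hm (by fun_prop)]
        simp_rw [hinner]
        have h1 := congrArg (fun μ => charFun μ 1) (hlaw I s)
        simp only [charFun_gaussianReal] at h1
        rw [charFun_apply_real, integral_map (by fun_prop) (by fun_prop)] at h1
        simp only [Complex.ofReal_one, one_mul] at h1
        rw [h1]
        push_cast
        simp
        ring_nf
    exact key.continuous_comp (g := WithLp.ofLp) (PiLp.continuous_ofLp 2 _)

/-! ### Decomposition into linear and quadratic parts -/

/-- The zero total removes the constant term and symmetry merges the two cross terms into row sums.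
With `x` the indicator of a group, `(s, t) = (-p, 1)` gives the centered indicator and `(1, -1)`
that of the complement. -/
lemma sum_mul_affine_mul_affine {ι : Type*} [Fintype ι] {b : ι → ι → ℝ}
    (hsymm : ∀ i j, b i j = b j i) (hsum : ∑ i, ∑ j, b i j = 0) (s t : ℝ) (x : ι → ℝ) :
    ∑ i, ∑ j, b i j * ((s + t * x i) * (s + t * x j)) =
      t ^ 2 * ∑ i, ∑ j, b i j * (x i * x j) + 2 * s * t * ∑ i, x i * ∑ j, b i j := by
  have h1 : ∑ i, ∑ j, b i j * x i = ∑ i, x i * ∑ j, b i j := by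
    simp_rw [← Finset.sum_mul, mul_comm]
  have h2 : ∑ i, ∑ j, b i j * x j = ∑ i, x i * ∑ j, b i j := by
    rw [Finset.sum_comm, ← h1]
    simp_rw [fun i j => hsymm i j]
  calc _ = s ^ 2 * ∑ i, ∑ j, b i j + t ^ 2 * ∑ i, ∑ j, b i j * (x i * x j) +
        s * t * (∑ i, ∑ j, b i j * x i + ∑ i, ∑ j, b i j * x j) := by
        simp only [Finset.mul_sum, ← Finset.sum_add_distrib]
        exact Finset.sum_congr rfl fun i _ => Finset.sum_congr rfl fun j _ => by ring
    _ = _ := by rw [h1, h2, hsum]; ring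

section Decomposition

variable {X : Type*} {n : ℕ} (k : X → X → ℝ) (y : Fin n → X)

@[simp] lemma ktilde_self (i : Fin n) : ktilde k y i i = 0 := by simp [ktilde]

lemma ktilde_comm (hk : ∀ x x', k x x' = k x' x) (i j : Fin n) :
    ktilde k y i j = ktilde k y j i := by
  simp [ktilde, hk (y i), eq_comm]

lemma rowSum_eq_sum (i : Fin n) : rowSum k y i = ∑ j, ktilde k y i j := by
  rw [rowSum, Finset.sum_filter]
  refine Finset.sum_congr rfl fun j _ => ?_
  split_ifs with h
  · rfl
  · rw [not_not.1 h, ktilde_self]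

lemma sum_sum_ktilde_group (σ : Equiv.Perm (Fin n)) (G : Finset (Fin n)) :
    ∑ i ∈ G, ∑ j ∈ G, ktilde k y (σ i) (σ j) =
      ∑ i ∈ G, ∑ j ∈ G with j ≠ i, k (y (σ i)) (y (σ j)) -
        (G.card : ℝ) * ((G.card : ℝ) - 1) * kbar k y := by
  have h : ∀ i ∈ G, ∑ j ∈ G, ktilde k y (σ i) (σ j) =
      ∑ j ∈ G with j ≠ i, k (y (σ i)) (y (σ j)) - ((G.card : ℝ) - 1) * kbar k y := by
    intro i hi
    have h1 : ∑ j ∈ G, ktilde k y (σ i) (σ j) =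
        ∑ j ∈ G with j ≠ i, (k (y (σ i)) (y (σ j)) - kbar k y) := by
      rw [Finset.sum_filter]
      refine Finset.sum_congr rfl fun j _ => ?_
      by_cases hij : j = i
      · simp [hij]
      · simp [ktilde, hij, Ne.symm hij]
    have h2 : ((G.filter fun j => j ≠ i).card : ℝ) = (G.card : ℝ) - 1 := by
      rw [Finset.filter_ne', Finset.card_erase_of_mem hi,
        Nat.cast_sub (Finset.card_pos.2 ⟨i, hi⟩)]
      simp
    rw [h1, Finset.sum_sub_distrib, Finset.sum_const, nsmul_eq_mul, h2]
  rw [Finset.sum_congr rfl h, Finset.sum_sub_distrib, Finset.sum_const, nsmul_eq_mul, mul_assoc]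

lemma sum_sum_ktilde (hn : 2 ≤ n) : ∑ i, ∑ j, ktilde k y i j = 0 := by
  have h := sum_sum_ktilde_group k y 1 Finset.univ
  have hn' : (2 : ℝ) ≤ n := by exact_mod_cast hn
  have h1 : (n : ℝ) - 1 ≠ 0 := by linarith
  have h2 : (n : ℝ) ≠ 0 := by linarith
  simp only [Equiv.Perm.one_apply, Finset.card_univ, Fintype.card_fin, kbar] at h
  rw [h]
  field_simp
  ring

lemma sum_rowSum (hn : 2 ≤ n) : ∑ i, rowSum k y i = 0 := by
  simp_rw [rowSum_eq_sum]
  exact sum_sum_ktilde k y hn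

lemma card_mul_withinMean (σ : Equiv.Perm (Fin n)) (G : Finset (Fin n)) :
    (G.card : ℝ) * ((G.card : ℝ) - 1) * withinMean k (y ∘ σ) G =
      ∑ i ∈ G, ∑ j ∈ G, ktilde k y (σ i) (σ j) +
        (G.card : ℝ) * ((G.card : ℝ) - 1) * kbar k y := by
  rw [sum_sum_ktilde_group, sub_add_cancel, withinMean]
  -- For groups of at most one element the prefactor is 1/0 = 0, but the sum over distinct pairs is
  -- empty too, so the identity persists.
  by_cases h : (G.card : ℝ) * ((G.card : ℝ) - 1) = 0
  · have h1 : G.card ≤ 1 := by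
      rcases mul_eq_zero.1 h with h | h
      · rw [Nat.cast_eq_zero] at h
        omega
      · exact_mod_cast (sub_eq_zero.1 h).le
    rw [h, zero_mul]
    refine (Finset.sum_eq_zero fun i hi => Finset.sum_eq_zero fun j hj => ?_).symm
    rw [Finset.mem_filter] at hj
    exact absurd (Finset.card_le_one.1 h1 j hj.1 i hi) hj.2
  · rw [← mul_assoc, mul_one_div_cancel h, one_mul]
    rfl

/-- The centered indicator of a group. -/
noncomputable def groupScore (G : Finset (Fin n)) (i : Fin n) : ℝ := (if i ∈ G then 1 else 0) - (G.card : ℝ) / n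

/-- The degenerate quadratic part of the two-group statistics. -/
noncomputable def quadraticPart (G : Finset (Fin n)) (σ : Equiv.Perm (Fin n)) : ℝ :=
  ∑ i, ∑ j, ktilde k y i j * (groupScore G (σ⁻¹ i) * groupScore G (σ⁻¹ j))

lemma sum_groupScore_mul (hn : n ≠ 0) (G H : Finset (Fin n)) :
    ∑ i, groupScore G i * groupScore H i =
      ((G ∩ H).card : ℝ) - (G.card : ℝ) * H.card / n := by
  have hn' : (n : ℝ) ≠ 0 := by exact_mod_cast hn
  have h : ∀ i, groupScore G i * groupScore H i = (if i ∈ G ∩ H then 1 else 0) -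
      (if i ∈ G then 1 else 0) * ((H.card : ℝ) / n) - (G.card : ℝ) / n * (if i ∈ H then 1 else 0) +
        (G.card : ℝ) / n * ((H.card : ℝ) / n) := by
    intro i
    simp only [groupScore, Finset.mem_inter]
    by_cases h1 : i ∈ G <;> by_cases h2 : i ∈ H <;> simp [h1, h2] <;> ring
  simp only [h, Finset.sum_add_distrib, Finset.sum_sub_distrib, ← Finset.sum_mul,
    ← Finset.mul_sum, Finset.sum_ite_mem, Finset.univ_inter, Finset.sum_const, nsmul_eq_mul,
    Finset.card_univ, Fintype.card_fin]
  field_simp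
  ring

lemma sum_groupScore (hn : n ≠ 0) (G : Finset (Fin n)) : ∑ i, groupScore G i = 0 := by
  have hn' : (n : ℝ) ≠ 0 := by exact_mod_cast hn
  simp only [groupScore, Finset.sum_sub_distrib, Finset.sum_ite_mem, Finset.univ_inter,
    Finset.sum_const, nsmul_eq_mul, Finset.card_univ, Fintype.card_fin]
  field_simp
  ring

lemma abs_groupScore_le (G : Finset (Fin n)) (i : Fin n) : |groupScore G i| ≤ 1 := by
  have h0 : (0 : ℝ) ≤ (G.card : ℝ) / n := by positivity
  have h1 : (G.card : ℝ) / n ≤ 1 := by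
    apply div_le_one_of_le₀ _ (Nat.cast_nonneg _)
    exact_mod_cast (Finset.card_le_univ G).trans_eq (Fintype.card_fin n)
  rw [abs_le, groupScore]
  split_ifs <;> constructor <;> linarith

/-- The two within-group sums share the same quadratic part and differ by a linear term only. Hence
their difference, which governs D, is purely linear. -/
lemma sum_sum_ktilde_group_eq (hk : ∀ x x', k x x' = k x' x) (hn : 2 ≤ n)
    (G : Finset (Fin n)) (σ : Equiv.Perm (Fin n)) :
    ∑ i ∈ G, ∑ j ∈ G, ktilde k y (σ i) (σ j) =
      quadraticPart k y G σ +
        2 * ((G.card : ℝ) / n) * linearStat (groupScore G) (rowSum k y) σ ∧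
    ∑ i ∈ Gᶜ, ∑ j ∈ Gᶜ, ktilde k y (σ i) (σ j) =
      ∑ i ∈ G, ∑ j ∈ G, ktilde k y (σ i) (σ j) -
        2 * linearStat (groupScore G) (rowSum k y) σ := by
  have hsum : ∑ i, ∑ j, ktilde k y (σ i) (σ j) = 0 := by
    rw [← sum_sum_ktilde k y hn, ← Equiv.sum_comp σ fun i => ∑ j, ktilde k y i j]
    exact Finset.sum_congr rfl fun i _ => Equiv.sum_comp σ fun j => ktilde k y (σ i) j
  have hrow : ∀ i, ∑ j, ktilde k y (σ i) (σ j) = rowSum k y (σ i) := fun i => by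
    rw [rowSum_eq_sum]
    exact Equiv.sum_comp σ fun j => ktilde k y (σ i) j
  have hlin : ∑ i, (if i ∈ G then (1 : ℝ) else 0) * rowSum k y (σ i) =
      linearStat (groupScore G) (rowSum k y) σ := by
    simp only [linearStat, groupScore, sub_mul, Finset.sum_sub_distrib, ← Finset.mul_sum]
    rw [Equiv.sum_comp σ (rowSum k y), sum_rowSum k y hn]
    ring
  have hgroup : ∀ H : Finset (Fin n), ∑ i ∈ H, ∑ j ∈ H, ktilde k y (σ i) (σ j) =
      ∑ i, ∑ j, ktilde k y (σ i) (σ j) *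
        ((if i ∈ H then 1 else 0) * (if j ∈ H then 1 else 0)) := fun H => by
    simp [Finset.sum_ite_mem]
  have haff := sum_mul_affine_mul_affine (b := fun i j => ktilde k y (σ i) (σ j))
    (fun i j => ktilde_comm k y hk _ _) hsum
  simp only [hrow] at haff
  constructor
  · have h := haff (-((G.card : ℝ) / n)) 1 fun i => if i ∈ G then 1 else 0
    rw [← hgroup, hlin] at h
    -- `quadraticPart` sums over observations, with a fixed kernel matrix and permuted scores, the
    -- form suited to moment bounds; reindexing by `σ` returns to positions.
    have hq : quadraticPart k y G σ = ∑ i, ∑ j, ktilde k y (σ i) (σ j) *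
        ((-((G.card : ℝ) / n) + 1 * if i ∈ G then 1 else 0) *
          (-((G.card : ℝ) / n) + 1 * if j ∈ G then 1 else 0)) := by
      have hinv : ∀ i, σ⁻¹ (σ i) = i := σ.symm_apply_apply
      rw [quadraticPart, ← Equiv.sum_comp σ]
      refine Finset.sum_congr rfl fun i _ => ?_
      rw [← Equiv.sum_comp σ]
      refine Finset.sum_congr rfl fun j _ => ?_
      simp only [hinv, groupScore]
      ring
    rw [hq, h]
    ring
  · have h := haff 1 (-1) fun i => if i ∈ G then 1 else 0
    rw [← hgroup, hlin] at h
    have hc : ∀ i, (if i ∈ Gᶜ then (1 : ℝ) else 0) = 1 + -1 * if i ∈ G then 1 else 0 := fun i => by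
      by_cases hi : i ∈ G <;> simp [hi]
    rw [hgroup Gᶜ]
    simp only [hc]
    rw [h]
    ring

lemma card_compl_cast (G : Finset (Fin n)) : ((Gᶜ.card : ℕ) : ℝ) = n - G.card := by
  rw [Finset.card_compl, Fintype.card_fin, Nat.cast_sub]
  exact (Finset.card_le_univ G).trans_eq (Fintype.card_fin n)

lemma statD_eq (hk : ∀ x x', k x x' = k x' x) (hn : 2 ≤ n) (G : Finset (Fin n)) :
    ∃ K : ℝ, ∀ σ : Equiv.Perm (Fin n), statD k (y ∘ σ) G =
      2 * linearStat (groupScore G) (rowSum k y) σ + K := by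
  refine ⟨((G.card : ℝ) * ((G.card : ℝ) - 1) - (Gᶜ.card : ℝ) * ((Gᶜ.card : ℝ) - 1)) * kbar k y,
    fun σ => ?_⟩
  obtain ⟨-, h⟩ := sum_sum_ktilde_group_eq k y hk hn G σ
  simp only [statD, alpha, beta]
  rw [← card_compl_cast, card_mul_withinMean, card_mul_withinMean, h]
  ring

/-- Weighting the two sums by r(1-p) and p leaves the linear coefficient 2p(1-p)(r-1); at r = 1 it
vanishes and only the quadratic part would remain. -/
lemma statW_eq (r : ℝ) (hk : ∀ x x', k x x' = k x' x) (hn : 2 ≤ n) (G : Finset (Fin n)) :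
    ∃ K : ℝ, ∀ σ : Equiv.Perm (Fin n), statW r k (y ∘ σ) G =
      (r * (1 - (G.card : ℝ) / n) + (G.card : ℝ) / n) * quadraticPart k y G σ +
      2 * ((G.card : ℝ) / n) * (1 - (G.card : ℝ) / n) * (r - 1) *
        linearStat (groupScore G) (rowSum k y) σ + K := by
  have hn' : (n : ℝ) ≠ 0 := by
    have : n ≠ 0 := by omega
    exact_mod_cast this
  refine ⟨(r * (1 - (G.card : ℝ) / n) * ((G.card : ℝ) * ((G.card : ℝ) - 1)) +
    (G.card : ℝ) / n * ((Gᶜ.card : ℝ) * ((Gᶜ.card : ℝ) - 1))) * kbar k y, fun σ => ?_⟩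
  obtain ⟨h1, h2⟩ := sum_sum_ktilde_group_eq k y hk hn G σ
  simp only [statW, alpha, beta]
  rw [mul_assoc _ ((G.card : ℝ) * _), mul_assoc ((G.card : ℝ) / n), sub_div, div_self hn',
    ← card_compl_cast, card_mul_withinMean, card_mul_withinMean, h2, h1]
  ring

end Decomposition

/-! ### Limits of normalized statistics -/

/-- Standardization ignores positive affine changes, so neither the constants of the decomposition
nor the scale √R affect the limit. -/
lemma standardize_eq {n : ℕ} {f H : Equiv.Perm (Fin n) → ℝ} {s K : ℝ} (hs : 0 < s)
    (hf : ∀ σ, f σ = s * H σ + K) (hH : 𝔼 σ, H σ = 0) (σ : Equiv.Perm (Fin n)) :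
    standardize f σ = H σ / √(𝔼 τ, H τ ^ 2) := by
  have h1 : ∫ τ, f τ ∂(permNull n) = K := by
    rw [integral_permNull_real]
    simp_rw [hf]
    rw [Finset.expect_add_distrib, ← Finset.mul_expect, hH, Fintype.expect_const]
    ring
  have h2 : Var[f; permNull n] = s ^ 2 * 𝔼 τ, H τ ^ 2 := by
    rw [variance_eq_integral Measurable.of_discrete.aemeasurable, h1, integral_permNull_real,
      Finset.mul_expect]
    refine Finset.expect_congr rfl fun τ _ => ?_
    rw [hf]
    ring
  rw [standardize, h1, h2, hf, Real.sqrt_mul (sq_nonneg s), Real.sqrt_sq hs.le, add_sub_cancel_right,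
    mul_div_mul_left _ _ hs.ne']

/-- A linear statistic plus a remainder negligible in `L²` has the same normalization, in the limit,
as the linear statistic. -/
lemma tendsto_expect_normalized_sub_sq {u ℓ : (n : ℕ) → Equiv.Perm (Fin n) → ℝ} {b : ℕ → ℝ}
    {B w : ℝ} (hw : 0 < w) (hB : B ≠ 0) (hu : Tendsto (fun n => 𝔼 σ, u n σ ^ 2) atTop (𝓝 0))
    (hℓ : Tendsto (fun n => 𝔼 σ, ℓ n σ ^ 2) atTop (𝓝 w)) (hb : Tendsto b atTop (𝓝 B)) :
    Tendsto (fun n => 𝔼 σ, ((u n σ + b n * ℓ n σ) / √(𝔼 τ, (u n τ + b n * ℓ n τ) ^ 2) -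
      B / √(B ^ 2 * w) * ℓ n σ) ^ 2) atTop (𝓝 0) := by
  have hcross : Tendsto (fun n => 𝔼 σ, u n σ * ℓ n σ) atTop (𝓝 0) := by
    have h1 : Tendsto (fun n => √((𝔼 σ, u n σ ^ 2) * 𝔼 σ, ℓ n σ ^ 2)) atTop (𝓝 0) := by
      simpa using (hu.mul hℓ).sqrt
    refine squeeze_zero_norm (fun n => ?_) h1
    rw [Real.norm_eq_abs]
    exact Real.abs_le_sqrt (Finset.expect_mul_sq_le_sq_mul_sq _ _ _)
  set m : ℕ → ℝ := fun n => 𝔼 τ, (u n τ + b n * ℓ n τ) ^ 2 with hm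
  have hmeq : ∀ n, m n = 𝔼 σ, u n σ ^ 2 + 2 * b n * 𝔼 σ, u n σ * ℓ n σ + b n ^ 2 * 𝔼 σ, ℓ n σ ^ 2 :=
    fun n => by
      rw [hm, Finset.mul_expect, Finset.mul_expect, ← Finset.expect_add_distrib,
        ← Finset.expect_add_distrib]
      exact Finset.expect_congr rfl fun σ _ => by ring
  have hmlim : Tendsto m atTop (𝓝 (B ^ 2 * w)) := by
    have := (hu.add ((hb.const_mul 2).mul hcross)).add ((hb.pow 2).mul hℓ)
    simp only [mul_zero, zero_add] at this
    exact this.congr fun n => (hmeq n).symm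
  have hpos : 0 < B ^ 2 * w := by positivity
  have hs : 0 < √(B ^ 2 * w) := Real.sqrt_pos.2 hpos
  -- Expanding the square leaves three terms, tending to 1, -2 and 1.
  have heq : ∀ n, 𝔼 σ, ((u n σ + b n * ℓ n σ) / √(m n) - B / √(B ^ 2 * w) * ℓ n σ) ^ 2 =
      m n / √(m n) ^ 2 - 2 * (B / √(B ^ 2 * w)) * ((𝔼 σ, u n σ * ℓ n σ +
        b n * 𝔼 σ, ℓ n σ ^ 2) / √(m n)) + (B / √(B ^ 2 * w)) ^ 2 * 𝔼 σ, ℓ n σ ^ 2 := fun n => by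
    conv_rhs => rw [show m n / √(m n) ^ 2 = (𝔼 τ, (u n τ + b n * ℓ n τ) ^ 2) / √(m n) ^ 2 from rfl]
    rw [Finset.expect_div, Finset.mul_expect, ← Finset.expect_add_distrib, Finset.expect_div,
      Finset.mul_expect, Finset.mul_expect, ← Finset.expect_sub_distrib,
      ← Finset.expect_add_distrib]
    exact Finset.expect_congr rfl fun σ _ => by ring
  have hlim := ((hmlim.div (hmlim.sqrt.pow 2) (by positivity)).sub
    (((hcross.add (hb.mul hℓ)).div hmlim.sqrt hs.ne').const_mul (2 * (B / √(B ^ 2 * w))))).add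
    (hℓ.const_mul ((B / √(B ^ 2 * w)) ^ 2))
  refine (hlim.congr fun n => (heq n).symm).trans_eq ?_
  congr 1
  have h1 : √(B ^ 2 * w) ^ 2 = B ^ 2 * w := Real.sq_sqrt hpos.le
  rw [h1, div_self hpos.ne', div_pow, h1, zero_add]
  have h2 : 2 * (B / √(B ^ 2 * w)) * (B * w / √(B ^ 2 * w)) = 2 * (B ^ 2 * w) / √(B ^ 2 * w) ^ 2 := by
    ring
  rw [h2, h1]
  field_simp
  ring

/-- The combinatorial central limit theorem for triangular arrays. -/
lemma tendsto_charFun_linearStat {c d : (n : ℕ) → Fin n → ℝ} {C v : ℝ}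
    (hc : ∀ n i, |c n i| ≤ C) (hc0 : ∀ᶠ n in atTop, ∑ i, c n i = 0)
    (hd : ∀ᶠ n in atTop, ∑ i, d n i = 0) (hd2 : ∀ᶠ n in atTop, ∑ i, d n i ^ 2 = 1)
    (hd3 : Tendsto (fun n => ∑ i, |d n i| ^ 3) atTop (𝓝 0))
    (hd4 : Tendsto (fun n => ∑ i, d n i ^ 4) atTop (𝓝 0))
    (hv : Tendsto (fun n : ℕ => (∑ i, c n i ^ 2) / n) atTop (𝓝 v)) :
    Tendsto (fun n => 𝔼 σ, Complex.exp (linearStat (c n) (d n) σ * Complex.I)) atTop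
      (𝓝 (Real.exp (-v / 2) : ℂ)) := by
  have h1 : Tendsto (fun n : ℕ => ((Real.exp (-((∑ i, c n i ^ 2) / n) / 2) : ℝ) : ℂ)) atTop
      (𝓝 (Real.exp (-v / 2) : ℂ)) :=
    (Complex.continuous_ofReal.tendsto _).comp
      ((Real.continuous_exp.tendsto _).comp (hv.neg.div_const 2))
  have h2 : Tendsto (fun n : ℕ => 32 * C ^ 3 * ∑ i, |d n i| ^ 3 +
      (√(2 * C ^ 4 * ∑ i, d n i ^ 4) + 2 * C ^ 2 / n)) atTop (𝓝 0) := by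
    simpa using (hd3.const_mul (32 * C ^ 3)).add ((hd4.const_mul (2 * C ^ 4)).sqrt.add
      (tendsto_const_div_atTop_nhds_zero_nat (2 * C ^ 2)))
  have h3 : Tendsto (fun n => 𝔼 σ, Complex.exp (linearStat (c n) (d n) σ * Complex.I) -
      ((Real.exp (-((∑ i, c n i ^ 2) / n) / 2) : ℝ) : ℂ)) atTop (𝓝 0) := by
    refine squeeze_zero_norm' ?_ h2
    filter_upwards [hc0, hd, hd2, eventually_ge_atTop 2] with n hn0 hn1 hn2 hn
    have := norm_charFun_linearStat_sub_le (by simpa using hn) (hc n) hn0 hn1 hn2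
    simpa using this
  simpa using h3.add h1

/-! ### Gaussian limits for general families of groups -/

section Core

variable {X : ℕ → Type*} {k : (n : ℕ) → X n → X n → ℝ} {y : (n : ℕ) → Fin n → X n}

/-- The row sums, scaled to unit Euclidean norm. -/
noncomputable def unitRowSum {X : Type*} {n : ℕ} (k : X → X → ℝ) (y : Fin n → X) (i : Fin n) : ℝ :=
  rowSum k y i / √(∑ j, rowSum k y j ^ 2)

lemma linearStat_rowSum {X : Type*} {n : ℕ} {k : X → X → ℝ} {y : Fin n → X}
    (h : 0 < ∑ j, rowSum k y j ^ 2) (c : Fin n → ℝ) (σ : Equiv.Perm (Fin n)) :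
    linearStat c (rowSum k y) σ = √(∑ j, rowSum k y j ^ 2) * linearStat c (unitRowSum k y) σ := by
  have := (Real.sqrt_pos.2 h).ne'
  rw [linearStat, linearStat, Finset.mul_sum]
  refine Finset.sum_congr rfl fun i _ => ?_
  rw [unitRowSum]
  field_simp

lemma sum_unitRowSum {X : Type*} {n : ℕ} (k : X → X → ℝ) (y : Fin n → X) (hn : 2 ≤ n) :
    ∑ i, unitRowSum k y i = 0 := by
  simp_rw [unitRowSum, ← Finset.sum_div, sum_rowSum k y hn, zero_div]

lemma sum_unitRowSum_sq {X : Type*} {n : ℕ} {k : X → X → ℝ} {y : Fin n → X}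
    (h : 0 < ∑ j, rowSum k y j ^ 2) : ∑ i, unitRowSum k y i ^ 2 = 1 := by
  simp_rw [unitRowSum, div_pow, ← Finset.sum_div, Real.sq_sqrt h.le]
  exact div_self h.ne'

lemma tendsto_sum_abs_unitRowSum_pow
    (hpos : ∀ᶠ n : ℕ in atTop, 0 < ∑ i, rowSum (k n) (y n) i ^ 2)
    (cond1 : ∀ s : ℕ, 2 < s → (fun n : ℕ => ∑ i, |rowSum (k n) (y n) i| ^ s) =o[atTop]
        (fun n : ℕ => (∑ i, rowSum (k n) (y n) i ^ 2) ^ ((s : ℝ) / 2))) {s : ℕ} (hs : 2 < s) :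
    Tendsto (fun n => ∑ i, |unitRowSum (k n) (y n) i| ^ s) atTop (𝓝 0) := by
  refine (cond1 s hs).tendsto_div_nhds_zero.congr' ?_
  filter_upwards [hpos] with n hn
  rw [Finset.sum_div]
  refine Finset.sum_congr rfl fun i _ => ?_
  rw [unitRowSum, abs_div, div_pow, abs_of_nonneg (Real.sqrt_nonneg _), Real.sqrt_eq_rpow,
    ← Real.rpow_natCast, ← Real.rpow_natCast, ← Real.rpow_mul hn.le]
  congr 2
  ring

/-- In the second moment bound, the row sum term divided by ∑ `rowSum`² is 32/(n-3), and Condition 2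
handles the sum of squared entries. -/
lemma tendsto_expect_quadraticPart_sq (hsymm : ∀ (n : ℕ) (x x' : X n), k n x x' = k n x' x)
    (hpos : ∀ᶠ n : ℕ in atTop, 0 < ∑ i, rowSum (k n) (y n) i ^ 2)
    (cond2 : (fun n : ℕ => ∑ i, ∑ j with j ≠ i, ktilde (k n) (y n) i j ^ 2) =o[atTop]
        (fun n : ℕ => ∑ i, rowSum (k n) (y n) i ^ 2)) (G : (n : ℕ) → Finset (Fin n)) :
    Tendsto (fun n => 𝔼 σ, (quadraticPart (k n) (y n) (G n) σ /
      √(∑ j, rowSum (k n) (y n) j ^ 2)) ^ 2) atTop (𝓝 0) := by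
  have h1 : Tendsto (fun n : ℕ => 32 / ((n : ℝ) - 3)) atTop (𝓝 0) :=
    tendsto_const_nhds.div_atTop
      (tendsto_atTop_add_const_right _ (-3) tendsto_natCast_atTop_atTop)
  have h2 := h1.add (cond2.tendsto_div_nhds_zero.const_mul 16)
  rw [mul_zero, add_zero] at h2
  refine squeeze_zero' (Eventually.of_forall fun n => Finset.expect_nonneg fun _ _ => sq_nonneg _)
    ?_ h2
  filter_upwards [hpos, eventually_ge_atTop 4] with n hn hn4
  simp_rw [div_pow, ← Finset.expect_div, Real.sq_sqrt hn.le]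
  rw [div_le_iff₀ hn, add_mul, mul_assoc 16, div_mul_cancel₀ _ hn.ne']
  have h3 := expect_quadratic_sq_le (a := ktilde (k n) (y n)) (by simpa using hn4)
    (ktilde_comm _ _ (hsymm n)) (ktilde_self _ _) (sum_sum_ktilde _ _ (by omega))
    (sum_groupScore (by omega) (G n)) (abs_groupScore_le (G n))
  -- The scores are evaluated at `σ⁻¹`, which is uniform as well.
  rw [← expect_perm_inv] at h3
  simp_rw [← rowSum_eq_sum] at h3
  have h4 : ∀ i, ∑ j with j ≠ i, ktilde (k n) (y n) i j ^ 2 = ∑ j, ktilde (k n) (y n) i j ^ 2 :=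
    fun i => by
      rw [Finset.sum_filter]
      refine Finset.sum_congr rfl fun j _ => ?_
      split_ifs with h
      · rfl
      · simp [not_not.1 h]
  simp_rw [h4]
  simpa [quadraticPart] using h3

/-- The groups enter only through the limits of their normalized scalar products, encoded as a Gram
matrix of vectors `f t`. Nonzero `f t` and `B t` keep the linear part nondegenerate, so that it
absorbs the normalization. -/
theorem convergesToGaussian_standardize {T V : Type} [NormedAddCommGroup V]
    [InnerProductSpace ℝ V] [CompleteSpace V]
    (hsymm : ∀ (n : ℕ) (x x' : X n), k n x x' = k n x' x)
    (hpos : ∀ᶠ n : ℕ in atTop, 0 < ∑ i, rowSum (k n) (y n) i ^ 2)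
    (cond1 : ∀ s : ℕ, 2 < s → (fun n : ℕ => ∑ i, |rowSum (k n) (y n) i| ^ s) =o[atTop]
        (fun n : ℕ => (∑ i, rowSum (k n) (y n) i ^ 2) ^ ((s : ℝ) / 2)))
    (cond2 : (fun n : ℕ => ∑ i, ∑ j with j ≠ i, ktilde (k n) (y n) i j ^ 2) =o[atTop]
        (fun n : ℕ => ∑ i, rowSum (k n) (y n) i ^ 2))
    {G : (n : ℕ) → T → Finset (Fin n)} {f : T → V}
    (hG : ∀ s t, Tendsto (fun n => ((G n s ∩ G n t).card : ℝ) / n -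
      ((G n s).card : ℝ) / n * (((G n t).card : ℝ) / n)) atTop (𝓝 ⟪f s, f t⟫))
    (hf : ∀ t, f t ≠ 0) {F : (n : ℕ) → T → Equiv.Perm (Fin n) → ℝ} {A b K : ℕ → T → ℝ}
    {A' B : T → ℝ} (hA : ∀ t, Tendsto (A · t) atTop (𝓝 (A' t)))
    (hb : ∀ t, Tendsto (b · t) atTop (𝓝 (B t))) (hB : ∀ t, B t ≠ 0)
    (hF : ∀ᶠ n in atTop, ∀ t σ, F n t σ = A n t * quadraticPart (k n) (y n) (G n t) σ +
      b n t * linearStat (groupScore (G n t)) (rowSum (k n) (y n)) σ + K n t) :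
    ConvergesToGaussian fun n t => standardize (F n t) := by
  -- This is sign(B)/‖f‖: the limit has unit variance and remembers the sign of the linear
  -- coefficient.
  set κ : T → ℝ := fun t => B t / √(B t ^ 2 * ‖f t‖ ^ 2)
  refine convergesToGaussian_of_tendsto_charFun (fun t => κ t • f t) fun I l => ?_
  set ℓ : T → (n : ℕ) → Equiv.Perm (Fin n) → ℝ :=
    fun t n => linearStat (groupScore (G n t)) (unitRowSum (k n) (y n))
  have hprod : ∀ s t, Tendsto (fun n : ℕ => (∑ i, groupScore (G n s) i * groupScore (G n t) i) / n)
      atTop (𝓝 ⟪f s, f t⟫) := fun s t => by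
    refine (hG s t).congr' ?_
    filter_upwards [eventually_ge_atTop 2] with n hn
    have : (n : ℝ) ≠ 0 := by
      have : n ≠ 0 := by omega
      exact_mod_cast this
    rw [sum_groupScore_mul (by omega)]
    field_simp
  have hmain : Tendsto (fun n => 𝔼 σ,
      Complex.exp ((∑ t : I, l t * (κ t * ℓ t n σ) : ℝ) * Complex.I)) atTop
      (𝓝 (Real.exp (-‖∑ t : I, l t • κ t • f t‖ ^ 2 / 2) : ℂ)) := by
    -- Combining the scores over `t` gives one linear statistic with the same values, so the scalar
    -- central limit theorem yields all joint laws.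
    have h := tendsto_charFun_linearStat (C := ∑ t : I, |l t * κ t|)
      (c := fun n i => ∑ t : I, l t * κ t * groupScore (G n t) i)
      (d := fun n => unitRowSum (k n) (y n)) (v := ‖∑ t : I, l t • κ t • f t‖ ^ 2)
      ?_ ?_ ?_ ?_ ?_ ?_ ?_
    · convert! h using 5 with n σ
      refine congrArg Complex.ofReal ?_
      simp only [ℓ, linearStat, Finset.mul_sum, Finset.sum_mul]
      rw [Finset.sum_comm]
      exact Finset.sum_congr rfl fun i _ => Finset.sum_congr rfl fun t _ => by ring
    · intro n i
      refine (Finset.abs_sum_le_sum_abs _ _).trans (Finset.sum_le_sum fun t _ => ?_)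
      rw [abs_mul]
      exact mul_le_of_le_one_right (abs_nonneg _) (abs_groupScore_le _ _)
    · filter_upwards [eventually_ge_atTop 2] with n hn
      rw [Finset.sum_comm]
      simp_rw [← Finset.mul_sum, sum_groupScore (show n ≠ 0 by omega)]
      simp
    · filter_upwards [eventually_ge_atTop 2] with n hn using sum_unitRowSum _ _ hn
    · filter_upwards [hpos] with n hn using sum_unitRowSum_sq hn
    · exact tendsto_sum_abs_unitRowSum_pow hpos cond1 (by norm_num)
    · refine (tendsto_sum_abs_unitRowSum_pow hpos cond1 (s := 4) (by norm_num)).congr fun n => ?_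
      exact Finset.sum_congr rfl fun i _ => by rw [(by decide : Even 4).pow_abs]
    · have h1 : ‖∑ t : I, l t • κ t • f t‖ ^ 2 =
          ∑ s : I, ∑ t : I, l s * κ s * (l t * κ t) * ⟪f s, f t⟫ := by
        rw [← real_inner_self_eq_norm_sq, sum_inner]
        refine Finset.sum_congr rfl fun s _ => ?_
        rw [inner_sum]
        refine Finset.sum_congr rfl fun t _ => ?_
        simp only [inner_smul_left, inner_smul_right, RCLike.conj_to_real]
        ring
      rw [h1]
      refine (tendsto_finsetSum _ fun (s : I) _ => tendsto_finsetSum _ fun (t : I) _ =>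
        (hprod s t).const_mul (l s * κ s * (l t * κ t))).congr fun n => ?_
      simp only [sq, Finset.sum_div, Finset.mul_sum]
      rw [Finset.sum_comm (s := (Finset.univ : Finset (Fin n)))]
      refine Finset.sum_congr rfl fun s _ => ?_
      simp only [Finset.sum_mul, Finset.sum_div]
      rw [Finset.sum_comm (s := (Finset.univ : Finset (Fin n)))]
      exact Finset.sum_congr rfl fun t _ => Finset.sum_congr rfl fun i _ => by ring
  have hclose : ∀ t, Tendsto (fun n => 𝔼 σ, (standardize (F n t) σ - κ t * ℓ t n σ) ^ 2) atTop
      (𝓝 0) := fun t => by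
    have hnf : 0 < ‖f t‖ ^ 2 := by
      have := norm_pos_iff.2 (hf t)
      positivity
    have hℓ : Tendsto (fun n => 𝔼 σ, ℓ t n σ ^ 2) atTop (𝓝 (‖f t‖ ^ 2)) := by
      -- The finite-population variance carries 1/(n-1) where the Gram limit has 1/n.
      have h1 : Tendsto (fun n : ℕ => (n : ℝ) / ((n : ℝ) - 1)) atTop (𝓝 1) := by
        simpa [sub_eq_add_neg] using tendsto_natCast_div_add_atTop (-1 : ℝ)
      have h2 := h1.mul (hprod t t)
      rw [one_mul, real_inner_self_eq_norm_sq] at h2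
      refine h2.congr' ?_
      filter_upwards [hpos, eventually_ge_atTop 2] with n hn hn2
      have h3 := expect_linear_sq (by simpa using hn2) (groupScore (G n t))
        (sum_unitRowSum (k n) (y n) hn2)
      have hn0 : (n : ℝ) ≠ 0 := by
        have : n ≠ 0 := by omega
        exact_mod_cast this
      simp only [ℓ]
      refine Eq.trans ?_ h3.symm
      rw [sum_unitRowSum_sq hn, sum_groupScore (by omega), Fintype.card_fin]
      simp_rw [← sq]
      field_simp
      ring
    have hu : Tendsto (fun n => 𝔼 σ, (A n t * (quadraticPart (k n) (y n) (G n t) σ /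
        √(∑ j, rowSum (k n) (y n) j ^ 2))) ^ 2) atTop (𝓝 0) := by
      have h1 := ((hA t).pow 2).mul
        (tendsto_expect_quadraticPart_sq hsymm hpos cond2 fun n => G n t)
      rw [mul_zero] at h1
      refine h1.congr fun n => ?_
      rw [Finset.mul_expect]
      exact Finset.expect_congr rfl fun σ _ => by ring
    refine (tendsto_expect_normalized_sub_sq hnf (hB t) hu hℓ (hb t)).congr' ?_
    filter_upwards [hpos, hF, eventually_ge_atTop 2] with n hn hFn hn2
    have hs : 0 < √(∑ j, rowSum (k n) (y n) j ^ 2) := Real.sqrt_pos.2 hn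
    refine Finset.expect_congr rfl fun σ _ => ?_
    rw [standardize_eq (f := F n t) (K := K n t) hs (H := fun σ => A n t *
      (quadraticPart (k n) (y n) (G n t) σ / √(∑ j, rowSum (k n) (y n) j ^ 2)) + b n t * ℓ t n σ)]
    · intro σ
      rw [hFn, linearStat_rowSum hn]
      simp only [ℓ]
      field_simp
    · have h1 := expect_quadratic (a := ktilde (k n) (y n)) (ktilde_self _ _)
        (sum_sum_ktilde _ _ hn2) (groupScore (G n t))
      rw [← expect_perm_inv] at h1
      have h2 := expect_linear (groupScore (G n t)) (sum_unitRowSum (k n) (y n) hn2)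
      rw [Finset.expect_add_distrib, ← Finset.mul_expect, ← Finset.mul_expect,
        ← Finset.expect_div]
      change A n t * ((𝔼 σ, quadraticPart (k n) (y n) (G n t) σ) / _) + _ = 0
      have h3 : 𝔼 σ, quadraticPart (k n) (y n) (G n t) σ = 0 := h1
      have h4 : 𝔼 σ, ℓ t n σ = 0 := h2
      rw [h3, h4]
      simp
  have hdiff : Tendsto (fun n =>
      (𝔼 σ, Complex.exp ((∑ t : I, l t * standardize (F n t) σ : ℝ) * Complex.I)) -
      𝔼 σ, Complex.exp ((∑ t : I, l t * (κ t * ℓ t n σ) : ℝ) * Complex.I)) atTop (𝓝 0) := by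
    have h1 : Tendsto (fun n => √((∑ t : I, l t ^ 2) * ∑ t : I, 𝔼 σ,
        (standardize (F n t) σ - κ t * ℓ t n σ) ^ 2)) atTop (𝓝 0) := by
      have := ((tendsto_finsetSum Finset.univ fun (t : I) _ => hclose t).const_mul
        (∑ t : I, l t ^ 2)).sqrt
      simpa using this
    refine squeeze_zero_norm (fun n => ?_) h1
    have h2 := norm_integral_exp_sub_le
      (memLp_permNull fun σ : Equiv.Perm (Fin n) => ∑ t : I, l t * standardize (F n t) σ)
      (memLp_permNull fun σ : Equiv.Perm (Fin n) => ∑ t : I, l t * (κ t * ℓ t n σ))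
    simp_rw [integral_permNull_complex, integral_permNull_real] at h2
    refine h2.trans (Real.sqrt_le_sqrt ?_)
    rw [← Finset.expect_sum_comm, Finset.mul_expect]
    refine Finset.expect_le_expect fun σ _ => ?_
    rw [← Finset.sum_sub_distrib]
    simp_rw [← mul_sub]
    exact Finset.sum_mul_sq_le_sq_mul_sq _ _ _
  simpa using hdiff.add hmain

end Core

/-! ### Interval groups and Brownian bridge covariances -/

lemma initialGroup_eq (n t : ℕ) : initialGroup n t = intervalGroup n 0 t := by
  ext i
  simp [initialGroup, intervalGroup]

lemma intervalGroup_inter (n s t s' t' : ℕ) :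
    intervalGroup n s t ∩ intervalGroup n s' t' = intervalGroup n (max s s') (min t t') := by
  ext i
  simp only [intervalGroup, Finset.mem_inter, Finset.mem_filter, Finset.mem_univ, true_and]
  omega

lemma card_intervalGroup {n t : ℕ} (s : ℕ) (ht : t ≤ n) : (intervalGroup n s t).card = t - s := by
  have h : (intervalGroup n s t).map Fin.valEmbedding = Finset.Ico s t := by
    ext i
    simp only [intervalGroup, Finset.mem_map, Finset.mem_filter, Finset.mem_univ, true_and,
      Fin.valEmbedding_apply, Finset.mem_Ico]
    constructor
    · rintro ⟨j, hj, rfl⟩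
      omega
    · intro hi
      exact ⟨⟨i, by omega⟩, by simp only; omega, rfl⟩
  rw [← Finset.card_map Fin.valEmbedding, h, Nat.card_Ico]

/-- Asymptotic proportion of the overlap of two interval groups. -/
lemma tendsto_card_intervalGroup_inter_div {a b a' b' : ℝ} (ha : 0 ≤ a) (ha' : 0 ≤ a')
    (hb : 0 ≤ b) (hb1 : b ≤ 1) (hb' : 0 ≤ b') :
    Tendsto (fun n : ℕ => ((intervalGroup n ⌊(n : ℝ) * a⌋₊ ⌊(n : ℝ) * b⌋₊ ∩
      intervalGroup n ⌊(n : ℝ) * a'⌋₊ ⌊(n : ℝ) * b'⌋₊).card : ℝ) / n) atTop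
      (𝓝 (max (min b b' - max a a') 0)) := by
  have hfloor : ∀ {x : ℝ}, 0 ≤ x → Tendsto (fun n : ℕ => ((⌊(n : ℝ) * x⌋₊ : ℕ) : ℝ) / n) atTop
      (𝓝 x) := fun {x} hx => by
    simpa [Function.comp_def, mul_comm] using
      (tendsto_nat_floor_mul_div_atTop hx).comp tendsto_natCast_atTop_atTop
  refine ((((hfloor hb).min (hfloor hb')).sub ((hfloor ha).max (hfloor ha'))).max
    tendsto_const_nhds).congr fun n => ?_
  have hn0 : (0 : ℝ) ≤ n := Nat.cast_nonneg n
  have hbn : ⌊(n : ℝ) * b⌋₊ ≤ n := Nat.floor_le_of_le (by nlinarith)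
  rw [intervalGroup_inter, card_intervalGroup _ ((min_le_left _ _).trans hbn)]
  -- Truncated subtraction becomes the positive part, so disjoint intervals contribute zero overlap.
  have hsub : ∀ p q : ℕ, ((p - q : ℕ) : ℝ) = max ((p : ℝ) - q) 0 := fun p q => by
    rcases le_total q p with h | h
    · rw [Nat.cast_sub h, max_eq_left (sub_nonneg.2 (by exact_mod_cast h))]
    · rw [Nat.sub_eq_zero_of_le h, max_eq_right (sub_nonpos.2 (by exact_mod_cast h)), Nat.cast_zero]
  rw [hsub, Nat.cast_min, Nat.cast_max, ← max_div_div_right hn0, sub_div, ← min_div_div_right hn0,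
    ← max_div_div_right hn0, zero_div]

/-- Brownian bridge increments: vectors in a Hilbert space with the covariances of the centered
indicators of intervals. -/
lemma exists_bridge_increments :
    ∃ (V : Type) (_ : NormedAddCommGroup V) (_ : InnerProductSpace ℝ V) (_ : CompleteSpace V)
      (f : ℝ × ℝ → V), ∀ p q : ℝ × ℝ, 0 ≤ p.1 → p.2 ≤ 1 → 0 ≤ q.1 → q.2 ≤ 1 →
        ⟪f p, f q⟫ = max (min p.2 q.2 - max p.1 q.1) 0 -
          max (p.2 - p.1) 0 * max (q.2 - q.1) 0 := by
  let μ : Measure ℝ := volume.restrict (Set.Ioc 0 1)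
  let g : ℝ × ℝ → Lp ℝ 2 μ := fun p =>
    indicatorConstLp 2 (measurableSet_Ioc (a := p.1) (b := p.2)) (measure_ne_top μ _) (1 : ℝ)
  have hg : ∀ p q : ℝ × ℝ, 0 ≤ p.1 → p.2 ≤ 1 → ⟪g p, g q⟫ = max (min p.2 q.2 - max p.1 q.1) 0 := by
    intro p q hp hp'
    rw [L2.real_inner_indicatorConstLp_one_indicatorConstLp_one, Set.Ioc_inter_Ioc,
      measureReal_restrict_apply measurableSet_Ioc, Set.inter_eq_left.2, Real.volume_real_Ioc]
    exact Set.Ioc_subset_Ioc (hp.trans (le_max_left _ _)) ((min_le_left _ _).trans hp')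
  -- Subtracting the multiple of the constant function 1 projects the interval indicator onto the
  -- mean-zero functions of L²(0,1).
  refine ⟨Lp ℝ 2 μ, inferInstance, inferInstance, inferInstance,
    fun p => g p - max (p.2 - p.1) 0 • g (0, 1), fun p q hp hp' hq hq' => ?_⟩
  have h1 : ∀ p : ℝ × ℝ, 0 ≤ p.1 → p.2 ≤ 1 → ⟪g p, g (0, 1)⟫ = max (p.2 - p.1) 0 :=
    fun p hp hp' => by
      rw [hg p _ hp hp', min_eq_left hp', max_eq_left hp]
  have h2 : ⟪g (0, 1), g (0, 1)⟫ = 1 := by rw [h1] <;> norm_num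
  simp only [inner_sub_left, inner_sub_right, inner_smul_left, inner_smul_right,
    RCLike.conj_to_real]
  rw [hg p q hp hp', h1 p hp hp', h2, real_inner_comm, h1 q hq hq']
  ring

/-! ### Application to scan statistics -/

section Main

variable {X : ℕ → Type*} {k : (n : ℕ) → X n → X n → ℝ} {y : (n : ℕ) → Fin n → X n}

/-- Gaussian limit of the standardization of a statistic with vanishing quadratic part, along
groups that are intervals of positions. -/
theorem convergesToGaussian_intervalGroup
    (hsymm : ∀ (n : ℕ) (x x' : X n), k n x x' = k n x' x)
    (hpos : ∀ᶠ n : ℕ in atTop, 0 < ∑ i, rowSum (k n) (y n) i ^ 2)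
    (cond1 : ∀ s : ℕ, 2 < s → (fun n : ℕ => ∑ i, |rowSum (k n) (y n) i| ^ s) =o[atTop]
        (fun n : ℕ => (∑ i, rowSum (k n) (y n) i ^ 2) ^ ((s : ℝ) / 2)))
    (cond2 : (fun n : ℕ => ∑ i, ∑ j with j ≠ i, ktilde (k n) (y n) i j ^ 2) =o[atTop]
        (fun n : ℕ => ∑ i, rowSum (k n) (y n) i ^ 2))
    {T : Type} (e : T → ℝ × ℝ)
    (he : ∀ t, 0 ≤ (e t).1 ∧ (e t).1 < (e t).2 ∧ (e t).2 ≤ 1 ∧ (e t).2 - (e t).1 < 1)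
    {F : (n : ℕ) → Finset (Fin n) → Equiv.Perm (Fin n) → ℝ} {A b : ℝ → ℝ}
    (hA : Continuous A) (hb : Continuous b) (hb0 : ∀ p, 0 < p → p < 1 → b p ≠ 0)
    (hF : ∀ᶠ n in atTop, ∀ G, ∃ K : ℝ, ∀ σ, F n G σ =
      A ((G.card : ℝ) / n) * quadraticPart (k n) (y n) G σ +
      b ((G.card : ℝ) / n) * linearStat (groupScore G) (rowSum (k n) (y n)) σ + K) :
    ConvergesToGaussian fun n t => standardize
      (F n (intervalGroup n ⌊(n : ℝ) * (e t).1⌋₊ ⌊(n : ℝ) * (e t).2⌋₊)) := by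
  obtain ⟨V, _, _, _, f, hf⟩ := exists_bridge_increments
  set G : (n : ℕ) → T → Finset (Fin n) := fun n t =>
    intervalGroup n ⌊(n : ℝ) * (e t).1⌋₊ ⌊(n : ℝ) * (e t).2⌋₊
  have hinter : ∀ s t, Tendsto (fun n => ((G n s ∩ G n t).card : ℝ) / n) atTop
      (𝓝 (max (min (e s).2 (e t).2 - max (e s).1 (e t).1) 0)) := fun s t => by
    obtain ⟨h1, h2, h3, -⟩ := he s
    obtain ⟨h4, h5, -, -⟩ := he t
    exact tendsto_card_intervalGroup_inter_div h1 h4 (h1.trans h2.le) h3 (h4.trans h5.le)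
  have hcard : ∀ t, Tendsto (fun n => ((G n t).card : ℝ) / n) atTop
      (𝓝 ((e t).2 - (e t).1)) := fun t => by
    have h := hinter t t
    simp only [Finset.inter_self, min_self, max_self] at h
    rwa [max_eq_left (sub_nonneg.2 (he t).2.1.le)] at h
  have hmax : ∀ t, max ((e t).2 - (e t).1) 0 = (e t).2 - (e t).1 := fun t =>
    max_eq_left (sub_nonneg.2 (he t).2.1.le)
  choose! K hK using fun (n : ℕ) (h : ∀ G, ∃ K : ℝ, ∀ σ, F n G σ =
      A ((G.card : ℝ) / n) * quadraticPart (k n) (y n) G σ +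
      b ((G.card : ℝ) / n) * linearStat (groupScore G) (rowSum (k n) (y n)) σ + K) => h
  refine convergesToGaussian_standardize (f := fun t => f (e t)) (G := G)
    (F := fun n t => F n (G n t)) (K := fun n t => K n (G n t)) hsymm hpos cond1 cond2
    (fun s t => ?_) (fun t => ?_) (fun t => (hA.tendsto _).comp (hcard t))
    (fun t => (hb.tendsto _).comp (hcard t)) (fun t => ?_) ?_
  · rw [hf _ _ (he s).1 (he s).2.2.1 (he t).1 (he t).2.2.1, hmax, hmax]
    exact (hinter s t).sub ((hcard s).mul (hcard t))
  -- The squared norm is ℓ(1-ℓ) for an interval of length ℓ, positive because 0 < ℓ < 1.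
  · intro h0
    obtain ⟨h1, h2, h3, h4⟩ := he t
    have h := hf _ _ h1 h3 h1 h3
    rw [h0, inner_zero_left, min_self, max_self, hmax] at h
    nlinarith [mul_pos (sub_pos.2 h2) (sub_pos.2 h4)]
  · exact hb0 _ (sub_pos.2 (he t).2.1) (he t).2.2.2
  · filter_upwards [hF] with n hn t σ using hK n hn (G n t) σ

end Main

end KernelScan

theorem theorem1 {X : ℕ → Type*} (k : (n : ℕ) → X n → X n → ℝ)
    (hsymm : ∀ (n : ℕ) (x x' : X n), k n x x' = k n x' x)
    (y : (n : ℕ) → Fin n → X n)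
    (hpos : ∀ᶠ n : ℕ in atTop, 0 < ∑ i, KernelScan.rowSum (k n) (y n) i ^ 2)
    (cond1 : ∀ s : ℕ, 2 < s →
      (fun n : ℕ => ∑ i, |KernelScan.rowSum (k n) (y n) i| ^ s) =o[atTop]
        (fun n : ℕ => (∑ i, KernelScan.rowSum (k n) (y n) i ^ 2) ^ ((s : ℝ) / 2)))
    (cond2 :
      (fun n : ℕ => ∑ i, ∑ j with j ≠ i, KernelScan.ktilde (k n) (y n) i j ^ 2) =o[atTop]
        (fun n : ℕ => ∑ i, KernelScan.rowSum (k n) (y n) i ^ 2)) :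
    KernelScan.ConvergesToGaussian (fun (n : ℕ) (u : KernelScan.UnitTime) =>
        KernelScan.ZD (k n) (y n) (KernelScan.initialGroup n ⌊(n : ℝ) * u.1⌋₊)) ∧
    KernelScan.ConvergesToGaussian (fun (n : ℕ) (p : KernelScan.IntervalTime) =>
        KernelScan.ZD (k n) (y n)
          (KernelScan.intervalGroup n ⌊(n : ℝ) * p.1.1⌋₊ ⌊(n : ℝ) * p.1.2⌋₊)) ∧
    (∀ r : ℝ, r ≠ 1 →
      KernelScan.ConvergesToGaussian (fun (n : ℕ) (u : KernelScan.UnitTime) =>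
        KernelScan.ZW r (k n) (y n) (KernelScan.initialGroup n ⌊(n : ℝ) * u.1⌋₊))) ∧
    (∀ r : ℝ, r ≠ 1 →
      KernelScan.ConvergesToGaussian (fun (n : ℕ) (p : KernelScan.IntervalTime) =>
        KernelScan.ZW r (k n) (y n)
          (KernelScan.intervalGroup n ⌊(n : ℝ) * p.1.1⌋₊ ⌊(n : ℝ) * p.1.2⌋₊))) := by
  have hD : ∀ᶠ n in atTop, ∀ G, ∃ K : ℝ, ∀ σ : Equiv.Perm (Fin n),
      KernelScan.statD (k n) (y n ∘ σ) G =
      0 * KernelScan.quadraticPart (k n) (y n) G σ +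
      2 * KernelScan.linearStat (KernelScan.groupScore G) (KernelScan.rowSum (k n) (y n)) σ + K := by
    filter_upwards [eventually_ge_atTop 2] with n hn G
    simpa using KernelScan.statD_eq (k n) (y n) (hsymm n) hn G
  have hW : ∀ r : ℝ, ∀ᶠ n in atTop, ∀ G, ∃ K : ℝ, ∀ σ : Equiv.Perm (Fin n),
      KernelScan.statW r (k n) (y n ∘ σ) G =
        (r * (1 - (G.card : ℝ) / n) + (G.card : ℝ) / n) * KernelScan.quadraticPart (k n) (y n) G σ +
        2 * ((G.card : ℝ) / n) * (1 - (G.card : ℝ) / n) * (r - 1) * KernelScan.linearStat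
          (KernelScan.groupScore G) (KernelScan.rowSum (k n) (y n)) σ + K := fun r => by
    filter_upwards [eventually_ge_atTop 2] with n hn G using
      KernelScan.statW_eq (k n) (y n) r (hsymm n) hn G
  have hb0 : ∀ r : ℝ, r ≠ 1 → ∀ p : ℝ, 0 < p → p < 1 → 2 * p * (1 - p) * (r - 1) ≠ 0 :=
    fun r hr p h0 h1 => mul_ne_zero (mul_ne_zero (by positivity) (sub_ne_zero.2 h1.ne'))
      (sub_ne_zero.2 hr)
  have hunit : ∀ u : KernelScan.UnitTime, 0 ≤ ((0 : ℝ), u.1).1 ∧ ((0 : ℝ), u.1).1 < ((0 : ℝ), u.1).2 ∧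
      ((0 : ℝ), u.1).2 ≤ 1 ∧ ((0 : ℝ), u.1).2 - ((0 : ℝ), u.1).1 < 1 := fun u =>
    ⟨le_rfl, u.2.1, u.2.2.le, by simpa using u.2.2⟩
  have hint : ∀ p : KernelScan.IntervalTime, 0 ≤ p.1.1 ∧ p.1.1 < p.1.2 ∧ p.1.2 ≤ 1 ∧
      p.1.2 - p.1.1 < 1 := fun p => ⟨p.2.1.le, p.2.2.1, p.2.2.2.le, by linarith [p.2.1, p.2.2.2]⟩
  refine ⟨?_, ?_, fun r hr => ?_, fun r hr => ?_⟩
  -- Initial groups are intervals with left end 0, where the integer part of n · 0 vanishes.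
  · have := KernelScan.convergesToGaussian_intervalGroup hsymm hpos cond1 cond2
      (fun u : KernelScan.UnitTime => ((0 : ℝ), u.1)) hunit (A := fun _ => 0) (b := fun _ => 2)
      continuous_const continuous_const (fun _ _ _ => two_ne_zero) hD
    simpa [KernelScan.initialGroup_eq, KernelScan.ZD] using this
  · exact KernelScan.convergesToGaussian_intervalGroup hsymm hpos cond1 cond2
      (fun p : KernelScan.IntervalTime => p.1) hint (A := fun _ => 0) (b := fun _ => 2)
      continuous_const continuous_const (fun _ _ _ => two_ne_zero) hD
  · have := KernelScan.convergesToGaussian_intervalGroup hsymm hpos cond1 cond2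
      (fun u : KernelScan.UnitTime => ((0 : ℝ), u.1)) hunit (A := fun p => r * (1 - p) + p)
      (b := fun p => 2 * p * (1 - p) * (r - 1)) (by fun_prop) (by fun_prop) (hb0 r hr) (hW r)
    simpa [KernelScan.initialGroup_eq, KernelScan.ZW] using this
  · exact KernelScan.convergesToGaussian_intervalGroup hsymm hpos cond1 cond2
      (fun p : KernelScan.IntervalTime => p.1) hint (A := fun p => r * (1 - p) + p)
      (b := fun p => 2 * p * (1 - p) * (r - 1)) (by fun_prop) (by fun_prop) (hb0 r hr) (hW r)
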